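/- Let $\theta>0$. For $y,z\in\mathbb R^2$ put $y\Theta^{-1}z=\theta^{-1}(y_2z_1-y_1z_2)$, and let $\star$ be the Moyal product $$(a\star b)(x)=\frac1{(\pi\theta)^2}\iint a(x+y)\,b(x+z)\,e^{-2i\,y\Theta^{-1}z}\,d^2y\,d^2z ,$$ defined for Schwartz functions $a,b\in\mathcal S(\mathbb R^2)$, and as an iterated integral (the inner one over the variable of the Schwartz factor) for $a\in\mathcal S$, $b\in L^2(\mathbb R^2)$ and for $a$ a polynomial, $b\in\mathcal S$. Let $\mathcal A=(\mathcal S,\star)$; it acts on $L^2(\mathbb R^2)$ by the bounded operators $L(a)b=a\star b$. Let $\bar{\mathcal A}$ be the norm closure of $L(\mathcal A)$, a $C^*$-algebra. On $L^2(\mathbb R^2)\otimes\mathbb C^2$ let $\pi(a)=L(a)\otimes 1$ and let $D=-i\sigma^\mu\partial_\mu$, with $\sigma^1=\begin{pmatrix}0&1\\1&0\end{pmatrix}$, $\sigma^2=\begin{pmatrix}0&i\\-i&0\end{pmatrix}$, on the domain of smooth spinors all of whose derivatives are square integrable. The spectral distance between two states of $\bar{\mathcal A}$ is $$d(\omega_1,\omega_2)=\sup\{|\omega_1(a)-\omega_2(a)|:\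 a\in\mathcal A,\ \|[D,\pi(a)]\|_{\rm op}\le 1\}\in[0,+\infty].$$ Let $f_{00}(x)=2e^{-(x_1^2+x_2^2)/\theta}$, $\bar z=(x_1-ix_2)/\sqrt2$ and $f_{m0}=(\theta^m m!)^{-1/2}\,\bar z^{\star m}\star f_{00}$ for $m\in\mathbb N=\{0,1,2,\dots\}$. For a unit vector $\psi\in L^2(\mathbb R^2)$ write $\omega_\psi(a)=\langle\psi,L(a)\psi\rangle$, extended continuously to $\bar{\mathcal A}$. Then the following hold. 1. For every $n\in\mathbb N$ the vector $(2\pi\theta)^{-1/2}f_{n0}$ is a unit vector of $L^2(\mathbb R^2)$, and its vector functional $\omega_n$ is a state of $\bar{\mathcal A}$. 2. For every real $s>1$ the series $\psi(s)=\frac1{\sqrt{2\pi\theta}}\sum_{m\ge0}\sqrt{\frac1{\zeta(s)(m+1)^s}}\;f_{m0}$ converges in $L^2(\mathbb R^2)$ to a unit vector, and $\omega_{\psi(s)}$ is a state of $\bar{\mathcal A}$. 3. $d(\omega_n,\omega_{\psi(s)})=+\infty$ for every $s\in\,]1,\tfrac32]$ and every $n\in\mathbb N$. 4. The topology induced by $d$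 on the space of all states of $\bar{\mathcal A}$ (that of the open $d$-balls) is not the weak$^*$ topology. -/

import Mathlib

open MeasureTheory Complex
open scoped ENNReal SchwartzMap ContDiff InnerProductSpace ComplexOrder

noncomputable section

namespace Moyal

/-- The plane `ℝ²`, with its Euclidean norm and Lebesgue measure. -/
abbrev Plane : Type := EuclideanSpace ℝ (Fin 2)

/-- The Hilbert space `L²(ℝ²)` of complex square integrable functions; its inner product
`⟪f, g⟫_ℂ` is antilinear in `f`. -/
abbrev L2 : Type := Lp ℂ 2 (volume : Measure Plane)

/-! ### The Moyal product -/

/-- The bilinear form `y Θ⁻¹ z`, where `Θ = θ (0 1; -1 0)`, so that `Θ⁻¹ = θ⁻¹ (0 -1; 1 0)`. -/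
def form (θ : ℝ) (y z : Plane) : ℝ := (y 1 * z 0 - y 0 * z 1) / θ

/-- The phase `exp (-2 i y Θ⁻¹ z)`. -/
def phase (θ : ℝ) (y z : Plane) : ℂ := cexp (-(2 * I * (form θ y z : ℂ)))

/-- The Moyal product
`(a ⋆ b)(x) = (πθ)⁻² ∫∫ a (x + y) b (x + z) exp (-2 i y Θ⁻¹ z) dy dz`, the integral over `y` being
done first. When `a` is a Schwartz function the inner integral is a Schwartz function of `z`, so
that both integrals converge absolutely for every `b` in `L²` (and for every Schwartz `b`, for
which the order of integration is immaterial). -/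
def moyalStar (θ : ℝ) (a b : Plane → ℂ) (x : Plane) : ℂ :=
  (((Real.pi * θ) ^ 2)⁻¹ : ℝ) * ∫ z : Plane, (∫ y : Plane, a (x + y) * phase θ y z) * b (x + z)

/-- The same Moyal product with the integral over `z` done first. When `b` is a Schwartz function
both integrals converge absolutely for every polynomially bounded continuous `a`, so that this is
the product of polynomials with Schwartz functions. -/
def starPoly (θ : ℝ) (a b : Plane → ℂ) (x : Plane) : ℂ :=
  (((Real.pi * θ) ^ 2)⁻¹ : ℝ) * ∫ y : Plane, a (x + y) * ∫ z : Plane, b (x + z) * phase θ y z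

/-! ### The operator `L(a)` of left Moyal multiplication on `L²(ℝ²)` -/

lemma form_add_left (θ : ℝ) (x y z : Plane) : form θ (x + y) z = form θ x z + form θ y z := by
  simp only [form, PiLp.add_apply]; ring

lemma norm_phase (θ : ℝ) (y z : Plane) : ‖phase θ y z‖ = 1 := by
  have : -(2 * I * (form θ y z : ℂ)) = ((-(2 * form θ y z) : ℝ) : ℂ) * I := by
    push_cast; ring
  rw [phase, this, Complex.norm_exp_ofReal_mul_I]

lemma continuous_phase (θ : ℝ) : Continuous fun p : Plane × Plane => phase θ p.1 p.2 := by
  unfold phase form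
  fun_prop

lemma phase_sub_left (θ : ℝ) (x y z : Plane) : phase θ (y - x) z = phase θ (-x) z * phase θ y z := by
  rw [phase, phase, phase, ← Complex.exp_add, sub_eq_neg_add, form_add_left]
  push_cast; ring_nf

/-- The linear map `z ↦ (πθ)⁻¹ (-z₂, z₁)`. -/
def rot (θ : ℝ) (hθ : θ ≠ 0) : Plane ≃L[ℝ] Plane :=
  LinearEquiv.toContinuousLinearEquiv
    { toFun := fun z => !₂[-(Real.pi * θ)⁻¹ * z 1, (Real.pi * θ)⁻¹ * z 0]
      invFun := fun z => !₂[Real.pi * θ * z 1, -(Real.pi * θ) * z 0]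
      map_add' := fun x y => by ext i; fin_cases i <;> simp <;> ring
      map_smul' := fun c x => by ext i; fin_cases i <;> simp <;> ring
      left_inv := fun z => by
        have := Real.pi_ne_zero
        ext i; fin_cases i <;> simp <;> field_simp
      right_inv := fun z => by
        have := Real.pi_ne_zero
        ext i; fin_cases i <;> simp <;> field_simp }

/-- `z ↦ ∫ a(y) exp (-2 i y Θ⁻¹ z) dy` as a Schwartz function. -/
def symplFourier (θ : ℝ) (hθ : θ ≠ 0) (a : 𝓢(Plane, ℂ)) : 𝓢(Plane, ℂ) :=
  SchwartzMap.compCLMOfContinuousLinearEquiv ℂ (rot θ hθ) (FourierTransform.fourier a)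

lemma symplFourier_apply (θ : ℝ) (hθ : θ ≠ 0) (a : 𝓢(Plane, ℂ)) (z : Plane) :
    symplFourier θ hθ a z = ∫ y, a y * phase θ y z := by
  simp only [symplFourier, SchwartzMap.compCLMOfContinuousLinearEquiv_apply, Function.comp,
    SchwartzMap.fourier_coe, Real.fourier_eq']
  refine integral_congr_ae (Filter.Eventually.of_forall fun y => ?_)
  simp only [smul_eq_mul, phase]
  rw [mul_comm]
  congr 2
  have h0 : rot θ hθ z 0 = -(Real.pi * θ)⁻¹ * z 1 := rfl
  have h1 : rot θ hθ z 1 = (Real.pi * θ)⁻¹ * z 0 := rfl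
  have hpi := Real.pi_ne_zero
  have : -2 * Real.pi * ⟪y, rot θ hθ z⟫_ℝ = -(2 * form θ y z) := by
    rw [PiLp.inner_apply, Fin.sum_univ_two, h0, h1, form]
    simp only [inner]
    field_simp
    simp
    field_simp
    ring
  rw [this]; push_cast; ring

lemma inner_integral (θ : ℝ) (hθ : θ ≠ 0) (a : 𝓢(Plane, ℂ)) (x z : Plane) :
    ∫ y, a (x + y) * phase θ y z = phase θ (-x) z * symplFourier θ hθ a z := by
  rw [symplFourier_apply, ← integral_const_mul,
    ← integral_add_left_eq_self (μ := volume) (fun y => phase θ (-x) z * (a y * phase θ y z)) x]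
  refine integral_congr_ae (Filter.Eventually.of_forall fun y => ?_)
  have := phase_sub_left θ x (x + y) z
  rw [add_sub_cancel_left] at this
  simp only [this]; ring

lemma moyalStar_eq (θ : ℝ) (hθ : θ ≠ 0) (a : 𝓢(Plane, ℂ)) (b : Plane → ℂ) (x : Plane) :
    moyalStar θ a b x = (((Real.pi * θ) ^ 2)⁻¹ : ℝ) *
      ∫ z : Plane, phase θ (-x) z * symplFourier θ hθ a z * b (x + z) := by
  simp only [moyalStar, inner_integral θ hθ]

lemma moyalStar_zero (a b : Plane → ℂ) : moyalStar 0 a b = 0 := by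
  ext x; simp [moyalStar]

lemma integrable_moyalStar (θ : ℝ) (hθ : θ ≠ 0) (a : 𝓢(Plane, ℂ)) {b : Plane → ℂ}
    (hb : MemLp b 2 volume) (x : Plane) :
    Integrable (fun z => phase θ (-x) z * symplFourier θ hθ a z * b (x + z)) := by
  have h1 : MemLp (fun z => phase θ (-x) z * symplFourier θ hθ a z) 2 volume := by
    refine ((symplFourier θ hθ a).memLp 2 volume).of_le ?_ ?_
    · have : Continuous fun z => phase θ (-x) z :=
        (continuous_phase θ).comp (by fun_prop : Continuous fun z : Plane => (-x, z))
      exact (this.mul (symplFourier θ hθ a).continuous).aestronglyMeasurable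
    · filter_upwards with z
      rw [norm_mul, norm_phase, one_mul]
  have h2 : MemLp (fun z => b (x + z)) 2 volume :=
    hb.comp_measurePreserving (measurePreserving_add_left volume x)
  exact h1.integrable_mul h2

lemma moyalStar_congr (θ : ℝ) (a : Plane → ℂ) {b b' : Plane → ℂ} (h : b =ᵐ[volume] b') :
    moyalStar θ a b = moyalStar θ a b' := by
  ext x
  have h' : (fun z => b (x + z)) =ᵐ[volume] fun z => b' (x + z) :=
    (measurePreserving_add_left volume x).quasiMeasurePreserving.ae_eq_comp h
  simp only [moyalStar]
  congr 1
  refine integral_congr_ae ?_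
  filter_upwards [h'] with z hz
  rw [hz]

lemma moyalStar_add (θ : ℝ) (a : 𝓢(Plane, ℂ)) {b b' : Plane → ℂ}
    (hb : MemLp b 2 volume) (hb' : MemLp b' 2 volume) :
    moyalStar θ a (b + b') = moyalStar θ a b + moyalStar θ a b' := by
  by_cases hθ : θ = 0
  · subst hθ; simp [moyalStar_zero]
  ext x
  simp only [moyalStar_eq θ hθ, Pi.add_apply, mul_add]
  rw [integral_add (integrable_moyalStar θ hθ a hb x) (integrable_moyalStar θ hθ a hb' x), mul_add]

lemma moyalStar_smul (θ : ℝ) (a : Plane → ℂ) (c : ℂ) (b : Plane → ℂ) :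
    moyalStar θ a (c • b) = c • moyalStar θ a b := by
  ext x
  simp only [moyalStar, Pi.smul_apply, smul_eq_mul]
  rw [mul_left_comm]
  congr 1
  rw [← integral_const_mul]
  congr 1
  funext z; ring

lemma aestronglyMeasurable_moyalStar (θ : ℝ) (a : 𝓢(Plane, ℂ)) {b : Plane → ℂ}
    (hb : AEStronglyMeasurable b volume) : AEStronglyMeasurable (moyalStar θ a b) volume := by
  by_cases hθ : θ = 0
  · subst hθ; rw [moyalStar_zero]; exact aestronglyMeasurable_zero
  have hEq : moyalStar θ a b = fun x => (((Real.pi * θ) ^ 2)⁻¹ : ℝ) *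
      ∫ z : Plane, phase θ (-x) z * symplFourier θ hθ a z * b (x + z) := by
    ext x; exact moyalStar_eq θ hθ a b x
  rw [hEq]
  have h1 : Continuous fun p : Plane × Plane => phase θ (-p.1) p.2 * symplFourier θ hθ a p.2 :=
    ((continuous_phase θ).comp (by fun_prop : Continuous fun p : Plane × Plane => (-p.1, p.2))).mul
      ((symplFourier θ hθ a).continuous.comp continuous_snd)
  have h2 : AEStronglyMeasurable (fun p : Plane × Plane => b (p.1 + p.2))
      ((volume : Measure Plane).prod volume) :=
    hb.comp_quasiMeasurePreserving (quasiMeasurePreserving_add _ _)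
  exact ((h1.aestronglyMeasurable.mul h2).integral_prod_right').const_mul _

/-- The Schur bound `‖a ⋆ b‖₂ ≤ C ‖b‖₂`. -/
lemma exists_moyalStar_bound (θ : ℝ) (a : 𝓢(Plane, ℂ)) : ∃ C : NNReal, ∀ b : Plane → ℂ,
    MemLp b 2 volume → eLpNorm (moyalStar θ a b) 2 volume ≤ C * eLpNorm b 2 volume := by
  by_cases hθ : θ = 0
  · refine ⟨0, fun b _ => ?_⟩
    subst hθ; simp [moyalStar_zero]
  set A := symplFourier θ hθ a with hA
  have hAfin : ∫⁻ z, ‖A z‖ₑ < ⊤ := A.integrable.2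
  have hAm : Measurable fun z => ‖A z‖ₑ := A.continuous.measurable.enorm
  set c : ℝ≥0∞ := ‖((((Real.pi * θ) ^ 2)⁻¹ : ℝ) : ℂ)‖ₑ with hc
  set K : ℝ≥0∞ := c * ∫⁻ z, ‖A z‖ₑ with hK
  have hKtop : K ≠ ⊤ := ENNReal.mul_ne_top enorm_ne_top hAfin.ne
  refine ⟨K.toNNReal, fun b hb => ?_⟩
  rw [ENNReal.coe_toNNReal hKtop]
  -- reduction to a measurable representative
  obtain ⟨b', hb'm, hbb'⟩ := hb.1
  rw [moyalStar_congr θ a hbb', eLpNorm_congr_ae hbb']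
  have hbm : Measurable fun z => ‖b' z‖ₑ := hb'm.measurable.enorm
  have hsq : ∀ f : Plane → ℂ, eLpNorm f 2 volume = (∫⁻ x, ‖f x‖ₑ ^ (2 : ℝ)) ^ (1 / 2 : ℝ) := by
    intro f
    rw [eLpNorm_eq_lintegral_rpow_enorm_toReal (by norm_num) (by norm_num)]
    norm_num
  -- the pointwise Cauchy-Schwarz inequality
  have hpt : ∀ x, ‖moyalStar θ a b' x‖ₑ ^ (2 : ℝ) ≤
      c ^ (2 : ℝ) * ((∫⁻ z, ‖A z‖ₑ) * ∫⁻ z, ‖A z‖ₑ * ‖b' (x + z)‖ₑ ^ (2 : ℝ)) := by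
    intro x
    have hbx : Measurable fun z => ‖b' (x + z)‖ₑ := hbm.comp (measurable_const_add x)
    have h1 : ‖moyalStar θ a b' x‖ₑ ≤ c * ∫⁻ z, ‖A z‖ₑ * ‖b' (x + z)‖ₑ := by
      rw [moyalStar_eq θ hθ, enorm_mul]
      gcongr
      refine (enorm_integral_le_lintegral_enorm _).trans (lintegral_mono fun z => ?_)
      rw [enorm_mul, enorm_mul, ← ofReal_norm (phase θ (-x) z), norm_phase]
      simp [hA]
    have h2 : ∫⁻ z, ‖A z‖ₑ * ‖b' (x + z)‖ₑ ≤
        (∫⁻ z, ‖A z‖ₑ) ^ (1 / 2 : ℝ) *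
          (∫⁻ z, ‖A z‖ₑ * ‖b' (x + z)‖ₑ ^ (2 : ℝ)) ^ (1 / 2 : ℝ) := by
      have h3 := ENNReal.lintegral_mul_le_Lp_mul_Lq volume Real.HolderConjugate.two_two
        (f := fun z => ‖A z‖ₑ ^ (1 / 2 : ℝ))
        (g := fun z => ‖A z‖ₑ ^ (1 / 2 : ℝ) * ‖b' (x + z)‖ₑ)
        (hAm.pow_const _).aemeasurable ((hAm.pow_const _).mul hbx).aemeasurable
      have e1 : ∀ t : ℝ≥0∞, t ^ (1 / 2 : ℝ) * t ^ (1 / 2 : ℝ) = t := fun t => by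
        rw [← ENNReal.rpow_add_of_nonneg _ _ (by norm_num) (by norm_num)]; norm_num
      have e2 : ∀ t : ℝ≥0∞, (t ^ (1 / 2 : ℝ)) ^ (2 : ℝ) = t := fun t => by
        rw [← ENNReal.rpow_mul]; norm_num
      simp only [Pi.mul_apply, ← mul_assoc, e1, e2,
        ENNReal.mul_rpow_of_nonneg _ _ (show (0 : ℝ) ≤ 2 by norm_num)] at h3
      exact h3
    calc ‖moyalStar θ a b' x‖ₑ ^ (2 : ℝ)
        ≤ (c * ((∫⁻ z, ‖A z‖ₑ) ^ (1 / 2 : ℝ) *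
          (∫⁻ z, ‖A z‖ₑ * ‖b' (x + z)‖ₑ ^ (2 : ℝ)) ^ (1 / 2 : ℝ))) ^ (2 : ℝ) := by
          gcongr
          exact h1.trans (by gcongr)
      _ = _ := by
          rw [ENNReal.mul_rpow_of_nonneg _ _ (by norm_num),
            ENNReal.mul_rpow_of_nonneg _ _ (by norm_num), ← ENNReal.rpow_mul, ← ENNReal.rpow_mul]
          norm_num
  have hF : Measurable fun p : Plane × Plane => ‖A p.2‖ₑ * ‖b' (p.1 + p.2)‖ₑ ^ (2 : ℝ) :=
    (hAm.comp measurable_snd).mul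
      ((hbm.comp (measurable_fst.add measurable_snd)).pow_const _)
  have hmain : ∫⁻ x, ‖moyalStar θ a b' x‖ₑ ^ (2 : ℝ) ≤
      K ^ (2 : ℝ) * ∫⁻ x, ‖b' x‖ₑ ^ (2 : ℝ) := by
    calc ∫⁻ x, ‖moyalStar θ a b' x‖ₑ ^ (2 : ℝ)
        ≤ ∫⁻ x, c ^ (2 : ℝ) *
            ((∫⁻ z, ‖A z‖ₑ) * ∫⁻ z, ‖A z‖ₑ * ‖b' (x + z)‖ₑ ^ (2 : ℝ)) := lintegral_mono hpt
      _ = c ^ (2 : ℝ) * ((∫⁻ z, ‖A z‖ₑ) *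
            ∫⁻ x, ∫⁻ z, ‖A z‖ₑ * ‖b' (x + z)‖ₑ ^ (2 : ℝ)) := by
          rw [lintegral_const_mul _ (hF.lintegral_prod_right'.const_mul _),
            lintegral_const_mul _ hF.lintegral_prod_right']
      _ = c ^ (2 : ℝ) * ((∫⁻ z, ‖A z‖ₑ) *
            ((∫⁻ z, ‖A z‖ₑ) * ∫⁻ x, ‖b' x‖ₑ ^ (2 : ℝ))) := by
          congr 2
          rw [lintegral_lintegral_swap hF.aemeasurable, ← lintegral_mul_const _ hAm]
          refine lintegral_congr fun z => ?_
          have hz : Measurable fun x => ‖b' (x + z)‖ₑ ^ (2 : ℝ) :=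
            (hbm.comp (measurable_add_const z)).pow_const _
          rw [lintegral_const_mul _ hz,
            lintegral_add_right_eq_self (fun x => ‖b' x‖ₑ ^ (2 : ℝ)) z]
      _ = K ^ (2 : ℝ) * ∫⁻ x, ‖b' x‖ₑ ^ (2 : ℝ) := by
          rw [hK, ENNReal.mul_rpow_of_nonneg _ _ (by norm_num : (0 : ℝ) ≤ 2), ENNReal.rpow_two,
            ENNReal.rpow_two]
          ring
  rw [hsq, hsq]
  calc (∫⁻ x, ‖moyalStar θ a b' x‖ₑ ^ (2 : ℝ)) ^ (1 / 2 : ℝ)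
      ≤ (K ^ (2 : ℝ) * ∫⁻ x, ‖b' x‖ₑ ^ (2 : ℝ)) ^ (1 / 2 : ℝ) := by gcongr
    _ = K * (∫⁻ x, ‖b' x‖ₑ ^ (2 : ℝ)) ^ (1 / 2 : ℝ) := by
        rw [ENNReal.mul_rpow_of_nonneg _ _ (by norm_num), ← ENNReal.rpow_mul]
        norm_num

lemma memLp_moyalStar (θ : ℝ) (a : 𝓢(Plane, ℂ)) {b : Plane → ℂ} (hb : MemLp b 2 volume) :
    MemLp (moyalStar θ a b) 2 volume := by
  obtain ⟨C, hC⟩ := exists_moyalStar_bound θ a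
  exact ⟨aestronglyMeasurable_moyalStar θ a hb.1,
    (hC b hb).trans_lt (ENNReal.mul_lt_top ENNReal.coe_lt_top hb.2)⟩

/-- The bounded operator `L(a) : b ↦ a ⋆ b` on `L²(ℝ²)`, for a Schwartz function `a`. -/
def leftMul (θ : ℝ) (a : 𝓢(Plane, ℂ)) : L2 →L[ℂ] L2 :=
  LinearMap.mkContinuousOfExistsBound
    { toFun := fun b => (memLp_moyalStar θ a (Lp.memLp b)).toLp (moyalStar θ a b)
      map_add' := fun b b' => by
        rw [← MemLp.toLp_add, MemLp.toLp_eq_toLp_iff,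
          ← moyalStar_add θ a (Lp.memLp b) (Lp.memLp b'), moyalStar_congr θ a (Lp.coeFn_add b b')]
      map_smul' := fun c b => by
        rw [RingHom.id_apply, ← MemLp.toLp_const_smul, MemLp.toLp_eq_toLp_iff,
          ← moyalStar_smul, moyalStar_congr θ a (Lp.coeFn_smul c b)] }
    (by
      obtain ⟨C, hC⟩ := exists_moyalStar_bound θ a
      refine ⟨C, fun b => ?_⟩
      simp only [LinearMap.coe_mk, AddHom.coe_mk, Lp.norm_toLp]
      rw [Lp.norm_def, ← ENNReal.coe_toReal, ← ENNReal.toReal_mul]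
      exact ENNReal.toReal_mono
        (ENNReal.mul_ne_top ENNReal.coe_ne_top (Lp.memLp b).2.ne) (hC b (Lp.memLp b)))

/-! ### The C*-algebra and its states -/

/-- The C*-completion of `(𝓢, ⋆)` for the operator norm: the norm closure, inside the bounded
operators on `L²(ℝ²)`, of the *-algebra generated by the operators `L(a)`, `a ∈ 𝓢`. (These
operators already form a *-algebra, `L` being a *-homomorphism.) -/
def cstar (θ : ℝ) : NonUnitalStarSubalgebra ℂ (L2 →L[ℂ] L2) :=
  (NonUnitalStarAlgebra.adjoin ℂ (Set.range (leftMul θ))).topologicalClosure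

/-- A Schwartz function, as an element of the C*-completion. -/
def toCstar (θ : ℝ) (a : 𝓢(Plane, ℂ)) : cstar θ :=
  ⟨leftMul θ a, NonUnitalStarSubalgebra.le_topologicalClosure _
    (NonUnitalStarAlgebra.subset_adjoin ℂ _ ⟨a, rfl⟩)⟩

/-- A state: a positive continuous linear functional of norm `sup {|φ(T)| : ‖T‖ ≤ 1} = 1`. -/
def IsState {θ : ℝ} (φ : WeakDual ℂ (cstar θ)) : Prop :=
  (∀ T : cstar θ, 0 ≤ φ (star T * T)) ∧
    IsLUB {r : ℝ | ∃ T : cstar θ, ‖T‖ ≤ 1 ∧ r = ‖φ T‖} 1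

/-- The state space. As a subtype of the weak dual it carries the weak* topology. -/
abbrev StateSpace (θ : ℝ) : Type := {φ : WeakDual ℂ (cstar θ) // IsState φ}

/-- The weak* topology of the state space. -/
abbrev weakStarTopology (θ : ℝ) : TopologicalSpace (StateSpace θ) := inferInstance

/-- The vector functional `ω_ψ(T) = ⟪ψ, T ψ⟫`. -/
def vectorState (θ : ℝ) (ψ : L2) : WeakDual ℂ (cstar θ) :=
  StrongDual.toWeakDual
    { toFun := fun T : cstar θ => inner ℂ ψ ((T : L2 →L[ℂ] L2) ψ)
      map_add' := fun S T => by simp [inner_add_right]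
      map_smul' := fun c T => by simp [inner_smul_right]
      cont := by fun_prop }

/-! ### The Dirac operator and the spectral distance -/

/-- The matrices `σ¹ = (0 1; 1 0)` and `σ² = (0 i; -i 0)`. -/
def pauli : Fin 2 → Matrix (Fin 2) (Fin 2) ℂ := ![!![0, 1; 1, 0], !![0, I; -I, 0]]

/-- Spinor fields. Those that are square integrable form `L²(ℝ²) ⊗ ℂ²`. -/
abbrev Spinor : Type := Plane → EuclideanSpace ℂ (Fin 2)

/-- The domain of the Dirac operator: smooth spinor fields all of whose derivatives (that of order
zero included) are square integrable. -/
def IsDiracDomain (ψ : Spinor) : Prop :=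
  ContDiff ℝ ∞ ψ ∧ ∀ k : ℕ, MemLp (iteratedFDeriv ℝ k ψ) 2 volume

/-- The Dirac operator `D = -i σ^μ ∂_μ`. -/
def dirac (ψ : Spinor) : Spinor := fun x =>
  -I • ∑ μ : Fin 2, WithLp.toLp 2
    ((pauli μ).mulVec (fderiv ℝ ψ x (EuclideanSpace.single μ 1)).ofLp)

/-- The representation `π(a)(ψ₁, ψ₂) = (a ⋆ ψ₁, a ⋆ ψ₂)`. -/
def rep (θ : ℝ) (a : 𝓢(Plane, ℂ)) (ψ : Spinor) : Spinor := fun x =>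
  WithLp.toLp 2 fun i => moyalStar θ a (fun w => ψ w i) x

/-- The commutator `[D, π(a)] ψ`. -/
def commutator (θ : ℝ) (a : 𝓢(Plane, ℂ)) (ψ : Spinor) : Spinor :=
  dirac (rep θ a ψ) - rep θ a (dirac ψ)

/-- The operator norm of `[D, π(a)]`, for the `L²` norm on the (dense) domain of `D`. -/
def commutatorNorm (θ : ℝ) (a : 𝓢(Plane, ℂ)) : ℝ≥0∞ :=
  ⨆ (ψ : Spinor) (_ : IsDiracDomain ψ),
    eLpNorm (commutator θ a ψ) 2 volume / eLpNorm ψ 2 volume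

/-- The spectral distance `d(φ₁, φ₂) = sup {|φ₁(a) - φ₂(a)| : a ∈ 𝓢, ‖[D, π(a)]‖ ≤ 1}`. -/
def spectralDist {θ : ℝ} (φ₁ φ₂ : WeakDual ℂ (cstar θ)) : ℝ≥0∞ :=
  ⨆ (a : 𝓢(Plane, ℂ)) (_ : commutatorNorm θ a ≤ 1),
    ‖φ₁ (toCstar θ a) - φ₂ (toCstar θ a)‖ₑ

/-- The spectral distance as an extended pseudometric on the state space. -/
@[reducible] def spectralMetric (θ : ℝ) : PseudoEMetricSpace (StateSpace θ) where
  edist φ₁ φ₂ := spectralDist φ₁.1 φ₂.1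
  edist_self φ := by simp [spectralDist]
  edist_comm φ₁ φ₂ := by
    simp only [spectralDist]
    refine iSup_congr fun a => iSup_congr fun _ => ?_
    rw [← enorm_neg, neg_sub]
  edist_triangle φ₁ φ₂ φ₃ := by
    refine iSup₂_le fun a ha => ?_
    have h : φ₁.1 (toCstar θ a) - φ₃.1 (toCstar θ a) =
        (φ₁.1 (toCstar θ a) - φ₂.1 (toCstar θ a)) +
          (φ₂.1 (toCstar θ a) - φ₃.1 (toCstar θ a)) := by ring
    rw [h]
    refine (enorm_add_le _ _).trans (add_le_add ?_ ?_)
    · exact le_iSup₂ (f := fun (a : 𝓢(Plane, ℂ)) (_ : commutatorNorm θ a ≤ 1) =>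
        ‖φ₁.1 (toCstar θ a) - φ₂.1 (toCstar θ a)‖ₑ) a ha
    · exact le_iSup₂ (f := fun (a : 𝓢(Plane, ℂ)) (_ : commutatorNorm θ a ≤ 1) =>
        ‖φ₂.1 (toCstar θ a) - φ₃.1 (toCstar θ a)‖ₑ) a ha

/-- The topology of the spectral distance on the state space (generated by the open balls). -/
@[reducible] def spectralTopology (θ : ℝ) : TopologicalSpace (StateSpace θ) :=
  (spectralMetric θ).toUniformSpace.toTopologicalSpace

/-! ### The matrix base functions `f_{m0}` and the vectors `ψ(s)` -/

/-- `f₀₀ = 2 exp (-2H/θ)` with `H = (x₁² + x₂²)/2`. -/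
def f00 (θ : ℝ) (x : Plane) : ℂ := 2 * cexp (-(2 * ((x 0 ^ 2 + x 1 ^ 2) / 2 : ℝ) / θ : ℂ))

/-- `z̄ = (x₁ - i x₂)/√2`. -/
def zbar (x : Plane) : ℂ := ((x 0 : ℂ) - I * (x 1 : ℂ)) / (Real.sqrt 2 : ℂ)

/-- `f_{m0} = (θ^m m!)^{-1/2} z̄ ⋆ (z̄ ⋆ ⋯ (z̄ ⋆ f₀₀))`, with `m` factors `z̄`. -/
def matrixBase (θ : ℝ) (m : ℕ) : Plane → ℂ :=
  ((Real.sqrt (θ ^ m * (m.factorial : ℝ)))⁻¹ : ℂ) • (starPoly θ zbar)^[m] (f00 θ)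

open Classical in
/-- The class in `L²(ℝ²)` of a square integrable function (and zero for other functions). -/
def toL2 (f : Plane → ℂ) : L2 := if h : MemLp f 2 volume then h.toLp f else 0

/-- The vector `(2πθ)^{-1/2} f_{n0}`. -/
def baseVector (θ : ℝ) (n : ℕ) : L2 :=
  ((Real.sqrt (2 * Real.pi * θ))⁻¹ : ℂ) • toL2 (matrixBase θ n)

/-- The coefficient `(ζ(s) (m+1)^s)^{-1/2}`; for real `s > 1` the number `ζ(s)` is real. -/
def psiCoeff (s : ℝ) (m : ℕ) : ℝ :=
  Real.sqrt (1 / ((riemannZeta (s : ℂ)).re * ((m : ℝ) + 1) ^ s))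

/-- `ψ(s) = (2πθ)^{-1/2} ∑ (ζ(s) (m+1)^s)^{-1/2} f_{m0}`, the series converging in `L²(ℝ²)`. -/
def psi (θ s : ℝ) : L2 := ∑' m : ℕ, (psiCoeff s m : ℂ) • baseVector θ m

end Moyal

end

noncomputable section

namespace Moyal

section

open FourierTransform LineDeriv

/-! ### Gaussians as Schwartz functions -/

/-! To make the distance infinite one needs test functions whose commutator with `D` stays bounded
while the two states differ by arbitrarily much. The vectors `f_{m0}` are multiples of `z̄^m exp
(-|x|²/θ)` and are joint eigenvectors of all `L(exp (-|x|²/(θ q)))`, with eigenvalue `q/(q+1)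
((q-1)/(q+1))^m` (`leftMul_gaussian_baseVector`): for large `q` this is a soft cut-off of the index
`m` at height `q`. The test functions are the sums `a_N = ∑_{k<N} 2^k exp (-|x|²/(θ 4^k))`, one
cut-off for each dyadic scale.

Upper bound. By the Leibniz rule the commutator norm is controlled by `‖L(∂_μ a)‖`
(`moyalStar_leibniz`, `commutatorNorm_le`). The operator `L(a)` is a superposition of unitary Weyl
translations weighted by the symplectic Fourier transform of `a`. For the summands of `∂_v a_N`
these transforms are the L¹-normalised dilates `4^k F(2^k z)` of one Schwartz function `F` of mean
zero. Each summand has norm `O(1)`, so the triangle inequality yields only `O(N)`. The cancellation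
in the more concentrated transform, played against the smoothness of the wider one, gives `⟪L(a_k)ψ,
L(a_l)ψ⟫ = O(2^{-|k-l|}) ‖ψ‖²`, hence a norm `O(√N)` (`inner_leftMul_leftMul_le`,
`exists_norm_sum_dilates_le`).

Lower bound. On the block `4^k ≤ m < 2·4^k` the state of `ψ(s)` has mass of order `4^{k(1-s)}`,
which is at least a constant times `2^{-k}` when `s ≤ 3/2`. There the `k`-th eigenvalue is smaller
than at `m = 0` by a fixed amount, so the factor `2^k` makes every scale contribute a constant
(`dyadic_gain`). The separation is at least `cN - 4n` (`dyadicSum_separates`), and after normalising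
the commutator it grows like `√N`.

The vectors are orthonormal by rotation invariance and a Gamma integral. Their functionals have norm
exactly one because wide Gaussians act as contractions tending to the identity on each `f_{m0}`. For
the topologies, the mixtures `(1-t) ω₀ + t ω_{ψ(s)}` tend weak* to `ω₀` as `t → 0`, whereas their
distance to `ω₀` is `t · ∞ = ∞` for every `t > 0`. -/

lemma one_add_norm_pow_mul_exp_bounded {b : ℝ} (hb : 0 < b) (n : ℕ) :
    ∃ C : ℝ, ∀ t : ℝ, 0 ≤ t → (1 + t) ^ n * Real.exp (-b * t ^ 2) ≤ C := by
  refine ⟨n.factorial * Real.exp (1 + b⁻¹), fun t ht => ?_⟩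
  have h1 : (1 + t) ^ n ≤ n.factorial * Real.exp (1 + t) := by
    have := Real.pow_div_factorial_le_exp (1 + t) (by positivity) n
    rwa [div_le_iff₀ (by positivity), mul_comm] at this
  calc (1 + t) ^ n * Real.exp (-b * t ^ 2)
      ≤ (n.factorial * Real.exp (1 + t)) * Real.exp (-b * t ^ 2) := by gcongr
    _ = n.factorial * Real.exp (1 + t + -b * t ^ 2) := by rw [mul_assoc, ← Real.exp_add]
    _ ≤ _ := by
      refine mul_le_mul_of_nonneg_left (Real.exp_le_exp.2 ?_) (by positivity)
      have h2 : t ≤ b⁻¹ + b * t ^ 2 := by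
        have h3 : b⁻¹ + b * t ^ 2 - t = b⁻¹ * ((b * t - 1 / 2) ^ 2 + 3 / 4) := by
          field_simp; ring
        have : 0 ≤ b⁻¹ * ((b * t - 1 / 2) ^ 2 + 3 / 4) := by positivity
        linarith
      linarith

/-- The real Gaussian `x ↦ exp (-b ‖x‖²)` as a Schwartz function. -/
def realGaussian (b : ℝ) (hb : 0 < b) : 𝓢(Plane, ℝ) where
  toFun x := Real.exp (-b * ‖x‖ ^ 2)
  smooth' := Real.contDiff_exp.comp (contDiff_const.mul (contDiff_norm_sq ℝ))
  decay' k n := by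
    have hf : Function.HasTemperateGrowth fun x : Plane => -b * ‖x‖ ^ 2 :=
      (Function.HasTemperateGrowth.const (-b)).mul (Function.hasTemperateGrowth_norm_sq Plane)
    obtain ⟨l, C, hC, hbd⟩ := hf.norm_iteratedFDeriv_le_uniform n
    obtain ⟨M, hM⟩ := one_add_norm_pow_mul_exp_bounded hb (k + l * n)
    refine ⟨n.factorial * (1 + C) ^ n * M, fun x => ?_⟩
    have hx : (1 : ℝ) ≤ 1 + ‖x‖ := by linarith [norm_nonneg x]
    -- Composition bound: every derivative of `exp` is `exp`, and those of the exponent grow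
    -- polynomially. The bound required on the `i`-th derivative is `D ^ i`, so `D` is enlarged to
    -- be at least one and a single factor of `D` suffices for every `i ≥ 1`.
    have h := norm_iteratedFDeriv_comp_le (𝕜 := ℝ) (g := Real.exp) (f := fun x : Plane => -b * ‖x‖ ^ 2)
      (n := n) (N := ∞) Real.contDiff_exp (contDiff_const.mul (contDiff_norm_sq ℝ)) (by exact_mod_cast le_top) x
      (C := Real.exp (-b * ‖x‖ ^ 2)) (D := (1 + C) * (1 + ‖x‖) ^ l)
      (fun i _ => by
        rw [norm_iteratedFDeriv_eq_norm_iteratedDeriv, iteratedDeriv_eq_iterate,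
          Real.iter_deriv_exp, Real.norm_of_nonneg (Real.exp_pos _).le])
      (fun i hi hin => by
        have hD : 1 ≤ (1 + C) * (1 + ‖x‖) ^ l :=
          one_le_mul_of_one_le_of_one_le (by linarith) (one_le_pow₀ hx)
        refine (hbd i hin x).trans (le_trans ?_ (le_self_pow₀ hD (by omega)))
        gcongr
        linarith)
    calc ‖x‖ ^ k * ‖iteratedFDeriv ℝ n (fun x : Plane => Real.exp (-b * ‖x‖ ^ 2)) x‖
        ≤ (1 + ‖x‖) ^ k *
          (n.factorial * Real.exp (-b * ‖x‖ ^ 2) * ((1 + C) * (1 + ‖x‖) ^ l) ^ n) := by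
          gcongr
          · linarith
          · exact h
      _ = n.factorial * (1 + C) ^ n * ((1 + ‖x‖) ^ (k + l * n) * Real.exp (-b * ‖x‖ ^ 2)) := by
          rw [mul_pow, ← pow_mul, pow_add]; ring
      _ ≤ _ := by
          gcongr
          exact hM _ (norm_nonneg x)

/-- The Gaussian `x ↦ exp (-b ‖x‖²)` as a complex Schwartz function. -/
def gaussian (b : ℝ) (hb : 0 < b) : 𝓢(Plane, ℂ) :=
  (realGaussian b hb).postcompCLM Complex.ofRealCLM

lemma gaussian_apply (b : ℝ) (hb : 0 < b) (x : Plane) :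
    gaussian b hb x = (Real.exp (-b * ‖x‖ ^ 2) : ℝ) := rfl

/-! ### The symplectic Fourier transform -/

/-- The rotation `(z₁, z₂) ↦ (-z₂, z₁)`. -/
def quarterTurn : Plane ≃ₗᵢ[ℝ] Plane where
  toFun z := !₂[-z 1, z 0]
  invFun z := !₂[z 1, -z 0]
  map_add' x y := by ext i; fin_cases i <;> simp; ring
  map_smul' c x := by ext i; fin_cases i <;> simp
  left_inv z := by ext i; fin_cases i <;> simp
  right_inv z := by ext i; fin_cases i <;> simp
  norm_map' z := by
    simp [EuclideanSpace.norm_eq, Fin.sum_univ_two, add_comm]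

lemma rot_eq_smul (θ : ℝ) (hθ : θ ≠ 0) (z : Plane) :
    rot θ hθ z = (Real.pi * θ)⁻¹ • quarterTurn z := by
  have h0 : rot θ hθ z 0 = -(Real.pi * θ)⁻¹ * z 1 := rfl
  have h1 : rot θ hθ z 1 = (Real.pi * θ)⁻¹ * z 0 := rfl
  have h2 : quarterTurn z 0 = - z 1 := rfl
  have h3 : quarterTurn z 1 = z 0 := rfl
  ext i
  fin_cases i
  · simp only [Fin.zero_eta, PiLp.smul_apply, smul_eq_mul, h0, h2]; ring
  · simp only [Fin.mk_one, PiLp.smul_apply, smul_eq_mul, h1, h3]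

/-- Matches the symplectic phase with the Euclidean Fourier character, so that Fourier inversion,
the derivative rule and the Gaussian formula carry over. -/
lemma pi_mul_inner_rot (θ : ℝ) (hθ : θ ≠ 0) (x z : Plane) :
    Real.pi * ⟪rot θ hθ z, x⟫_ℝ = form θ x z := by
  have h0 : rot θ hθ z 0 = -(Real.pi * θ)⁻¹ * z 1 := rfl
  have h1 : rot θ hθ z 1 = (Real.pi * θ)⁻¹ * z 0 := rfl
  rw [PiLp.inner_apply, Fin.sum_univ_two, h0, h1, form]
  simp only [inner]
  field_simp
  simp
  field_simp
  ring

lemma integral_comp_rot (θ : ℝ) (hθ : θ ≠ 0) (f : Plane → ℂ) :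
    ∫ z, f (rot θ hθ z) = ((Real.pi * θ) ^ 2 : ℝ) * ∫ z, f z := by
  simp only [rot_eq_smul]
  rw [(quarterTurn.measurePreserving).integral_comp
    quarterTurn.toHomeomorph.measurableEmbedding (fun z => f ((Real.pi * θ)⁻¹ • z)),
    Measure.integral_comp_smul, finrank_euclideanSpace_fin, inv_pow, inv_inv,
    abs_of_nonneg (by positivity), Complex.real_smul]

/-- Ordinary Fourier inversion after the substitution by `rot`, whose Jacobian `(πθ)²` cancels the
prefactor of the Moyal product. -/
lemma symplFourier_inversion (θ : ℝ) (hθ : θ ≠ 0) (a : 𝓢(Plane, ℂ)) (x : Plane) :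
    (((Real.pi * θ) ^ 2)⁻¹ : ℝ) * ∫ z, phase θ (-x) z * symplFourier θ hθ a z = a x := by
  have h : ∀ z, phase θ (-x) z * symplFourier θ hθ a z =
      (fun v => cexp (((2 * Real.pi * ⟪v, x⟫_ℝ : ℝ) : ℂ) * I) • 𝓕 a v) (rot θ hθ z) := by
    intro z
    have := pi_mul_inner_rot θ hθ x z
    simp only [symplFourier, SchwartzMap.compCLMOfContinuousLinearEquiv_apply, Function.comp,
      smul_eq_mul, mul_assoc, this, phase]
    congr 2
    have h2 : form θ (-x) z = - form θ x z := by simp [form]; ring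
    rw [h2]; push_cast; ring
  simp only [h]
  rw [integral_comp_rot θ hθ (fun v => cexp (((2 * Real.pi * ⟪v, x⟫_ℝ : ℝ) : ℂ) * I) • 𝓕 a v),
    SchwartzMap.fourier_coe, ← Real.fourierInv_eq', ← SchwartzMap.fourier_coe,
    ← SchwartzMap.fourierInv_coe, FourierTransform.fourierInv_fourier_eq, ← mul_assoc,
    ← Complex.ofReal_mul, inv_mul_cancel₀ (by positivity), Complex.ofReal_one, one_mul]

lemma symplFourier_lineDerivOp (θ : ℝ) (hθ : θ ≠ 0) (a : 𝓢(Plane, ℂ)) (m z : Plane) :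
    symplFourier θ hθ (∂_{m} a) z = 2 * I * (form θ m z : ℂ) * symplFourier θ hθ a z := by
  have := pi_mul_inner_rot θ hθ m z
  simp only [symplFourier, SchwartzMap.compCLMOfContinuousLinearEquiv_apply, Function.comp,
    SchwartzMap.fourier_lineDerivOp_eq, smul_apply, smul_eq_mul]
  rw [SchwartzMap.smulLeftCLM_apply_apply (Function.hasTemperateGrowth_inner_left m), ← this]
  simp only [Complex.real_smul]
  push_cast; ring

lemma symplFourier_gaussian (θ : ℝ) (hθ : θ ≠ 0) (b : ℝ) (hb : 0 < b) (z : Plane) :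
    symplFourier θ hθ (gaussian b hb) z =
      ((Real.pi / b * Real.exp (-(θ ^ 2 * b)⁻¹ * ‖z‖ ^ 2) : ℝ) : ℂ) := by
  simp only [symplFourier, SchwartzMap.compCLMOfContinuousLinearEquiv_apply, Function.comp,
    SchwartzMap.fourier_coe]
  have h1 : (⇑(gaussian b hb)) = fun x => cexp (-(b : ℂ) * ‖x‖ ^ 2) := by
    ext x; rw [gaussian_apply]; push_cast; rfl
  have hpi := Real.pi_ne_zero
  rw [h1, fourier_gaussian_innerProductSpace (by simpa using hb), rot_eq_smul, norm_smul,
    quarterTurn.norm_map, finrank_euclideanSpace_fin]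
  push_cast
  rw [div_self two_ne_zero, Complex.cpow_one]
  congr 2
  rw [mul_pow, Real.norm_eq_abs, ← Complex.ofReal_pow, ← Complex.ofReal_pow |(Real.pi * θ)⁻¹|, sq_abs]
  have : (θ : ℂ) ≠ 0 := by exact_mod_cast hθ
  push_cast
  field_simp

end

/-! ### Weyl operators -/

lemma phase_add_left (θ : ℝ) (x y z : Plane) : phase θ (x + y) z = phase θ x z * phase θ y z := by
  rw [phase, phase, phase, ← Complex.exp_add, form_add_left]
  push_cast; ring_nf

lemma phase_add_right (θ : ℝ) (x y z : Plane) : phase θ x (y + z) = phase θ x y * phase θ x z := by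
  have h : form θ x (y + z) = form θ x y + form θ x z := by simp [form]; ring
  rw [phase, phase, phase, ← Complex.exp_add, h]
  push_cast; ring_nf

@[simp] lemma phase_self (θ : ℝ) (x : Plane) : phase θ x x = 1 := by
  simp [phase, form, mul_comm]

@[simp] lemma phase_zero_left (θ : ℝ) (x : Plane) : phase θ 0 x = 1 := by simp [phase, form]

@[simp] lemma phase_zero_right (θ : ℝ) (x : Plane) : phase θ x 0 = 1 := by simp [phase, form]

lemma conj_phase (θ : ℝ) (x z : Plane) : (starRingEnd ℂ) (phase θ x z) = phase θ (-x) z := by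
  rw [phase, phase, ← Complex.exp_conj]
  congr 1
  have h : form θ (-x) z = - form θ x z := by simp [form]; ring
  have h2 : (starRingEnd ℂ) 2 = 2 := Complex.conj_ofNat 2
  simp [h, h2]

lemma phase_neg_right (θ : ℝ) (x z : Plane) : phase θ x (-z) = phase θ (-x) z := by
  have h : form θ (-x) z = form θ x (-z) := by simp only [form, PiLp.neg_apply]; ring
  rw [phase, phase, h]

lemma phase_swap (θ : ℝ) (x z : Plane) : phase θ x z = phase θ (-z) x := by
  have h : form θ (-z) x = form θ x z := by simp only [form, PiLp.neg_apply]; ring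
  rw [phase, phase, h]

/-- The Weyl translate `x ↦ exp (2 i x Θ⁻¹ z) ψ (x + z)` of a function. -/
def weylFun (θ : ℝ) (z : Plane) (ψ : Plane → ℂ) (x : Plane) : ℂ := phase θ (-x) z * ψ (x + z)

lemma eLpNorm_weylFun (θ : ℝ) (z : Plane) {ψ : Plane → ℂ} (hψ : AEStronglyMeasurable ψ volume) :
    eLpNorm (weylFun θ z ψ) 2 volume = eLpNorm ψ 2 volume := by
  rw [← eLpNorm_comp_measurePreserving hψ (measurePreserving_add_right volume z)]
  refine eLpNorm_congr_norm_ae (Filter.Eventually.of_forall fun x => ?_)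
  simp [weylFun, norm_phase]

lemma aestronglyMeasurable_weylFun (θ : ℝ) (z : Plane) {ψ : Plane → ℂ}
    (hψ : AEStronglyMeasurable ψ volume) : AEStronglyMeasurable (weylFun θ z ψ) volume := by
  have h1 : Continuous fun x => phase θ (-x) z :=
    (continuous_phase θ).comp (by fun_prop : Continuous fun x : Plane => (-x, z))
  exact h1.aestronglyMeasurable.mul
    (hψ.comp_measurePreserving (measurePreserving_add_right volume z))

lemma memLp_weylFun (θ : ℝ) (z : Plane) {ψ : Plane → ℂ} (hψ : MemLp ψ 2 volume) :
    MemLp (weylFun θ z ψ) 2 volume :=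
  ⟨aestronglyMeasurable_weylFun θ z hψ.1, by rw [eLpNorm_weylFun θ z hψ.1]; exact hψ.2⟩

/-- The Weyl operator on `L²(ℝ²)`. -/
def weyl (θ : ℝ) (z : Plane) (ψ : L2) : L2 := (memLp_weylFun θ z (Lp.memLp ψ)).toLp _

lemma coeFn_weyl (θ : ℝ) (z : Plane) (ψ : L2) : weyl θ z ψ =ᵐ[volume] weylFun θ z ψ :=
  MemLp.coeFn_toLp _

lemma norm_weyl (θ : ℝ) (z : Plane) (ψ : L2) : ‖weyl θ z ψ‖ = ‖ψ‖ := by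
  rw [weyl, Lp.norm_toLp, eLpNorm_weylFun θ z (Lp.aestronglyMeasurable ψ), Lp.norm_def]

lemma inner_weyl (θ : ℝ) (φ ψ : L2) (z : Plane) :
    inner ℂ φ (weyl θ z ψ) = ∫ x, (starRingEnd ℂ) (φ x) * (phase θ (-x) z * ψ (x + z)) := by
  rw [L2.inner_def]
  refine integral_congr_ae ?_
  filter_upwards [coeFn_weyl θ z ψ] with x hx
  rw [hx, RCLike.inner_apply, mul_comm]
  rfl

/-- Weyl translations compose up to a phase; the substitution `x ↦ x - w` collects both on one side.
This turns a translated vector into a phase-twisted shift of the Fourier weight. -/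
lemma inner_weyl_weyl (θ : ℝ) (ψ : L2) (w z : Plane) :
    inner ℂ (weyl θ w ψ) (weyl θ z ψ) = phase θ w z * inner ℂ ψ (weyl θ (z - w) ψ) := by
  rw [inner_weyl, inner_weyl, ← integral_const_mul,
    ← integral_sub_right_eq_self (fun x => (starRingEnd ℂ) ((weyl θ w ψ : L2) x) * _) w]
  refine integral_congr_ae ?_
  filter_upwards [((measurePreserving_sub_right volume w).quasiMeasurePreserving.ae_eq_comp
    (coeFn_weyl θ w ψ))] with x hx
  simp only [Function.comp] at hx
  rw [hx, weylFun, map_mul, conj_phase, sub_add_cancel, neg_neg,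
    show x - w + z = x + (z - w) by abel]
  have h1 : phase θ (-(x - w)) z = phase θ (-x) z * phase θ w z := by
    rw [← phase_add_left]; congr 1; abel
  have h2 : phase θ (x - w) w = phase θ x w := by
    rw [sub_eq_add_neg, phase_add_left, ← phase_neg_right θ w w]
    have := phase_add_right θ w w (-w)
    rw [phase_self, one_mul, add_neg_cancel, phase_zero_right] at this
    rw [← this, mul_one]
  have h3 : phase θ (-x) (z - w) = phase θ (-x) z * phase θ x w := by
    rw [sub_eq_add_neg, phase_add_right, phase_neg_right, neg_neg]
  rw [h1, h2, h3]
  ring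

lemma aestronglyMeasurable_weyl_kernel (θ : ℝ) (φ ψ : L2) :
    AEStronglyMeasurable (fun p : Plane × Plane =>
      (starRingEnd ℂ) (φ p.1) * (phase θ (-p.1) p.2 * ψ (p.1 + p.2)))
      ((volume : Measure Plane).prod volume) := by
  have h1 : Continuous fun p : Plane × Plane => phase θ (-p.1) p.2 :=
    (continuous_phase θ).comp (by fun_prop : Continuous fun p : Plane × Plane => (-p.1, p.2))
  have h2 : AEStronglyMeasurable (fun p : Plane × Plane => ψ (p.1 + p.2))
      ((volume : Measure Plane).prod volume) :=
    (Lp.aestronglyMeasurable ψ).comp_quasiMeasurePreserving (quasiMeasurePreserving_add _ _)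
  have h3 : AEStronglyMeasurable (fun p : Plane × Plane => (starRingEnd ℂ) (φ p.1))
      ((volume : Measure Plane).prod volume) :=
    RCLike.continuous_conj.comp_aestronglyMeasurable (Lp.aestronglyMeasurable φ).comp_fst
  exact h3.mul (h1.aestronglyMeasurable.mul h2)

lemma aestronglyMeasurable_inner_weyl (θ : ℝ) (φ ψ : L2) :
    AEStronglyMeasurable (fun z => inner ℂ φ (weyl θ z ψ)) volume := by
  simp only [inner_weyl]
  exact (aestronglyMeasurable_weyl_kernel θ φ ψ).prod_swap.integral_prod_right'

lemma norm_inner_weyl_le (θ : ℝ) (φ ψ : L2) (z : Plane) :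
    ‖inner ℂ φ (weyl θ z ψ)‖ ≤ ‖φ‖ * ‖ψ‖ :=
  (norm_inner_le_norm _ _).trans_eq (by rw [norm_weyl])

lemma integrable_mul_inner_weyl (θ : ℝ) (φ ψ : L2) {F : Plane → ℂ} (hF : Integrable F) :
    Integrable fun z => F z * inner ℂ φ (weyl θ z ψ) :=
  hF.mul_bdd (c := ‖φ‖ * ‖ψ‖) (aestronglyMeasurable_inner_weyl θ φ ψ)
    (Filter.Eventually.of_forall fun z => norm_inner_weyl_le θ φ ψ z)

/-- For fixed `z`, Cauchy–Schwarz in `x` bounds the integral by `|F z| ‖φ‖ ‖ψ‖`, uniformly in the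
translation. This justifies Fubini in `inner_leftMul`. -/
lemma integrable_weyl_kernel (θ : ℝ) (φ ψ : L2) {F : Plane → ℂ} (hF : Integrable F) :
    Integrable (fun p : Plane × Plane =>
      F p.2 * ((starRingEnd ℂ) (φ p.1) * (phase θ (-p.1) p.2 * ψ (p.1 + p.2))))
      ((volume : Measure Plane).prod volume) := by
  have hm := (hF.1.comp_snd (μ := (volume : Measure Plane))).mul
    (aestronglyMeasurable_weyl_kernel θ φ ψ)
  refine ⟨hm, ?_⟩
  rw [hasFiniteIntegral_iff_enorm]
  refine (lintegral_prod_symm _ hm.enorm).trans_lt ?_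
  have hb : ∀ z : Plane, ∫⁻ x, ‖F z * ((starRingEnd ℂ) (φ x) * (phase θ (-x) z * ψ (x + z)))‖ₑ ≤
      ‖F z‖ₑ * (eLpNorm φ 2 volume * eLpNorm ψ 2 volume) := by
    intro z
    have h := eLpNorm_smul_le_mul_eLpNorm (p := 2) (q := 2) (r := 1) (μ := volume)
      (f := weylFun θ z ψ) (φ := φ) (aestronglyMeasurable_weylFun θ z (Lp.aestronglyMeasurable ψ))
      (Lp.aestronglyMeasurable φ)
    rw [eLpNorm_weylFun θ z (Lp.aestronglyMeasurable ψ), eLpNorm_one_eq_lintegral_enorm] at h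
    calc ∫⁻ x, ‖F z * ((starRingEnd ℂ) (φ x) * (phase θ (-x) z * ψ (x + z)))‖ₑ
        = ∫⁻ x, ‖F z‖ₑ * ‖((φ : Plane → ℂ) • weylFun θ z ψ) x‖ₑ := by
          refine lintegral_congr fun x => ?_
          simp only [Pi.smul_apply', smul_eq_mul, enorm_mul, weylFun, RCLike.enorm_conj]
      _ = ‖F z‖ₑ * ∫⁻ x, ‖((φ : Plane → ℂ) • weylFun θ z ψ) x‖ₑ :=
          lintegral_const_mul' _ _ enorm_ne_top
      _ ≤ _ := by gcongr
  refine (lintegral_mono hb).trans_lt ?_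
  rw [lintegral_mul_const'' _ hF.1.enorm]
  exact ENNReal.mul_lt_top hF.2 (ENNReal.mul_lt_top (Lp.memLp φ).2 (Lp.memLp ψ).2)

/-! ### Left Moyal multiplication as a superposition of Weyl operators -/

lemma coeFn_leftMul (θ : ℝ) (a : 𝓢(Plane, ℂ)) (ψ : L2) :
    leftMul θ a ψ =ᵐ[volume] moyalStar θ a ψ :=
  MemLp.coeFn_toLp (memLp_moyalStar θ a (Lp.memLp ψ))

/-- Left Moyal multiplication is a weak integral of Weyl operators. -/
lemma inner_leftMul (θ : ℝ) (hθ : θ ≠ 0) (a : 𝓢(Plane, ℂ)) (φ ψ : L2) :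
    inner ℂ φ (leftMul θ a ψ) = (((Real.pi * θ) ^ 2)⁻¹ : ℝ) *
      ∫ z, symplFourier θ hθ a z * inner ℂ φ (weyl θ z ψ) := by
  simp only [inner_weyl, ← integral_const_mul]
  rw [integral_integral_swap
    (((integrable_weyl_kernel θ φ ψ (symplFourier θ hθ a).integrable).swap).const_mul _),
    L2.inner_def]
  refine integral_congr_ae ?_
  filter_upwards [coeFn_leftMul θ a ψ] with x hx
  rw [hx, RCLike.inner_apply, moyalStar_eq θ hθ, integral_const_mul, mul_assoc]
  congr 1
  rw [mul_comm, ← integral_const_mul]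
  refine integral_congr_ae (Filter.Eventually.of_forall fun z => ?_)
  simp only
  ring

lemma norm_inner_leftMul_le (θ : ℝ) (hθ : θ ≠ 0) (a : 𝓢(Plane, ℂ)) (φ ψ : L2) :
    ‖inner ℂ φ (leftMul θ a ψ)‖ ≤ ((Real.pi * θ) ^ 2)⁻¹ *
      (∫ z, ‖symplFourier θ hθ a z‖) * (‖φ‖ * ‖ψ‖) := by
  rw [inner_leftMul θ hθ, norm_mul, Complex.norm_real, Real.norm_of_nonneg (by positivity),
    mul_assoc, ← integral_mul_const]
  gcongr
  refine (norm_integral_le_integral_norm _).trans (integral_mono_of_nonneg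
    (Filter.Eventually.of_forall fun z => norm_nonneg _)
    ((symplFourier θ hθ a).integrable.norm.mul_const _) (Filter.Eventually.of_forall fun z => ?_))
  simp only [norm_mul]
  gcongr
  exact norm_inner_weyl_le θ φ ψ z

/-- Test the weak bound against `φ = L(a)ψ` and divide by `‖L(a)ψ‖`. -/
lemma norm_leftMul_le (θ : ℝ) (hθ : θ ≠ 0) (a : 𝓢(Plane, ℂ)) :
    ‖leftMul θ a‖ ≤ ((Real.pi * θ) ^ 2)⁻¹ * ∫ z, ‖symplFourier θ hθ a z‖ := by
  have hC : 0 ≤ ((Real.pi * θ) ^ 2)⁻¹ * ∫ z, ‖symplFourier θ hθ a z‖ :=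
    mul_nonneg (by positivity) (integral_nonneg fun _ => norm_nonneg _)
  refine ContinuousLinearMap.opNorm_le_bound _ hC fun ψ => ?_
  have h := norm_inner_leftMul_le θ hθ a (leftMul θ a ψ) ψ
  rw [inner_self_eq_norm_sq_to_K, norm_pow, RCLike.norm_ofReal, abs_norm] at h
  rcases (norm_nonneg (leftMul θ a ψ)).eq_or_lt' with h0 | h0
  · rw [h0]; positivity
  · nlinarith

/-! ### Linearity of `L` -/

lemma symplFourier_add (θ : ℝ) (hθ : θ ≠ 0) (a b : 𝓢(Plane, ℂ)) :
    symplFourier θ hθ (a + b) = symplFourier θ hθ a + symplFourier θ hθ b := by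
  simp [symplFourier, FourierTransform.fourier_add]

lemma symplFourier_smul (θ : ℝ) (hθ : θ ≠ 0) (c : ℂ) (a : 𝓢(Plane, ℂ)) :
    symplFourier θ hθ (c • a) = c • symplFourier θ hθ a := by
  simp [symplFourier, FourierTransform.fourier_smul]

/-- Left Moyal multiplication as a linear map. -/
def leftMulLinear (θ : ℝ) (hθ : θ ≠ 0) : 𝓢(Plane, ℂ) →ₗ[ℂ] (L2 →L[ℂ] L2) where
  toFun := leftMul θ
  map_add' a b := by
    ext1 ψ
    refine ext_inner_left ℂ fun φ => ?_
    rw [add_apply, inner_add_right, inner_leftMul θ hθ, inner_leftMul θ hθ,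
      inner_leftMul θ hθ, ← mul_add, ← integral_add
        (integrable_mul_inner_weyl θ φ ψ (symplFourier θ hθ a).integrable)
        (integrable_mul_inner_weyl θ φ ψ (symplFourier θ hθ b).integrable), symplFourier_add]
    simp only [add_apply, add_mul]
  map_smul' c a := by
    ext1 ψ
    refine ext_inner_left ℂ fun φ => ?_
    rw [RingHom.id_apply, smul_apply, inner_smul_right, inner_leftMul θ hθ,
      inner_leftMul θ hθ, mul_left_comm, symplFourier_smul]
    simp only [smul_apply, smul_eq_mul, mul_assoc, integral_const_mul]

lemma leftMulLinear_apply (θ : ℝ) (hθ : θ ≠ 0) (a : 𝓢(Plane, ℂ)) :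
    leftMulLinear θ hθ a = leftMul θ a := rfl

/-! ### Almost orthogonality of dilated multipliers -/

/-- Induction on `N`: adding `x N` costs `‖x N‖² ≤ C` plus twice the cross term with the previous
sum, which a geometric series bounds by `C`. Each step therefore costs at most `3C`. -/
lemma norm_sq_sum_le_of_almost_orthogonal {E : Type*} [NormedAddCommGroup E]
    [InnerProductSpace ℂ E] (x : ℕ → E) (C : ℝ)
    (h : ∀ k l : ℕ, k ≤ l → ‖inner ℂ (x k) (x l)‖ ≤ C * (1 / 2) ^ (l - k)) (N : ℕ) :
    ‖∑ k ∈ Finset.range N, x k‖ ^ 2 ≤ 3 * C * N := by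
  have hC : 0 ≤ C := by simpa using (norm_nonneg _).trans (h 0 0 le_rfl)
  induction N with
  | zero => simp
  | succ N ih =>
    rw [Finset.sum_range_succ, norm_add_sq (𝕜 := ℂ)]
    have h1 : ‖x N‖ ^ 2 ≤ C := by
      have := h N N le_rfl
      rw [inner_self_eq_norm_sq_to_K, norm_pow, RCLike.norm_ofReal, abs_norm] at this
      simpa using this
    -- The exponents `M - k` with `k < M` are at least one, so the series is bounded by `1` rather
    -- than `2`.
    have hgeom : ∀ M : ℕ, ∑ k ∈ Finset.range M, (1 / 2 : ℝ) ^ (M - k) ≤ 1 := by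
      intro M
      induction M with
      | zero => simp
      | succ M ihM =>
        rw [Finset.sum_range_succ]
        have : ∑ k ∈ Finset.range M, (1 / 2 : ℝ) ^ (M + 1 - k) =
            (1 / 2) * ∑ k ∈ Finset.range M, (1 / 2 : ℝ) ^ (M - k) := by
          rw [Finset.mul_sum]
          refine Finset.sum_congr rfl fun k hk => ?_
          rw [Nat.succ_sub (Finset.mem_range.1 hk).le, pow_succ']
        rw [this, Nat.add_sub_cancel_left]
        linarith
    have h2 : RCLike.re (inner ℂ (∑ k ∈ Finset.range N, x k) (x N)) ≤ C := by
      refine (RCLike.re_le_norm _).trans ?_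
      rw [sum_inner]
      refine (norm_sum_le _ _).trans ?_
      calc ∑ k ∈ Finset.range N, ‖inner ℂ (x k) (x N)‖
          ≤ ∑ k ∈ Finset.range N, C * (1 / 2) ^ (N - k) :=
            Finset.sum_le_sum fun k hk => h k N (Finset.mem_range.1 hk).le
        _ = C * ∑ k ∈ Finset.range N, (1 / 2) ^ (N - k) := by rw [Finset.mul_sum]
        _ ≤ C := mul_le_of_le_one_right hC (hgeom N)
    push_cast
    linarith

/-- The `L¹` modulus of continuity of a Schwartz function. -/
lemma integral_norm_translate_sub_le (F : 𝓢(Plane, ℂ)) (w : Plane) :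
    ∫ z, ‖F (z + w) - F z‖ ≤ ‖w‖ * ∫ z, ‖fderiv ℝ F z‖ := by
  have hcont : Continuous fun z => ‖fderiv ℝ F z‖ :=
    ((F.smooth 1).continuous_fderiv (by norm_num)).norm
  have hint : Integrable fun z => ‖fderiv ℝ F z‖ := by
    have := (SchwartzMap.fderivCLM ℝ Plane ℂ F).integrable (μ := volume)
    exact this.norm
  -- Fundamental theorem of calculus along the segment from `z` to `z + w`. Once integrated over
  -- `z`, translation invariance removes the dependence on the position along the segment.
  have hpt : ∀ z, ‖F (z + w) - F z‖ ≤ ∫ t in (0 : ℝ)..1, ‖fderiv ℝ F (z + t • w)‖ * ‖w‖ := by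
    intro z
    have hd : ∀ t : ℝ, HasDerivAt (fun t : ℝ => F (z + t • w)) (fderiv ℝ F (z + t • w) w) t := by
      intro t
      have h1 : HasDerivAt (fun t : ℝ => z + t • w) w t := by
        simpa using ((hasDerivAt_id t).smul_const w).const_add z
      exact (F.hasFDerivAt (z + t • w)).comp_hasDerivAt t h1
    have hc : Continuous fun t : ℝ => fderiv ℝ F (z + t • w) w :=
      (((F.smooth 1).continuous_fderiv (by norm_num)).comp (by fun_prop)).clm_apply
        continuous_const
    have h := intervalIntegral.integral_eq_sub_of_hasDerivAt (a := 0) (b := 1)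
      (fun t _ => hd t) (hc.intervalIntegrable _ _)
    rw [one_smul, zero_smul, add_zero] at h
    rw [← h]
    refine (intervalIntegral.norm_integral_le_integral_norm zero_le_one).trans ?_
    refine intervalIntegral.integral_mono zero_le_one (hc.norm.intervalIntegrable _ _)
      (((hcont.comp (by fun_prop : Continuous fun t : ℝ => z + t • w)).mul
        continuous_const).intervalIntegrable _ _) fun t => ContinuousLinearMap.le_opNorm _ _
  have hprod : Integrable (fun p : Plane × ℝ => ‖fderiv ℝ F (p.1 + p.2 • w)‖ * ‖w‖)
      ((volume : Measure Plane).prod (volume.restrict (Set.Ioc (0 : ℝ) 1))) := by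
    have hm : Continuous fun p : Plane × ℝ => ‖fderiv ℝ F (p.1 + p.2 • w)‖ * ‖w‖ :=
      (hcont.comp (by fun_prop)).mul continuous_const
    rw [integrable_prod_iff' hm.aestronglyMeasurable]
    refine ⟨Filter.Eventually.of_forall fun t => (hint.comp_add_right (t • w)).mul_const _, ?_⟩
    simp only [norm_mul, norm_norm, integral_mul_const,
      integral_add_right_eq_self (fun z => ‖fderiv ℝ F z‖)]
    exact integrable_const _
  have hL : Integrable fun z => ‖F (z + w) - F z‖ :=
    ((F.integrable.comp_add_right w).sub F.integrable).norm
  simp only [intervalIntegral.integral_of_le zero_le_one] at hpt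
  refine (integral_mono hL hprod.integral_prod_left hpt).trans_eq ?_
  rw [integral_integral_swap hprod]
  simp only [integral_mul_const, integral_add_right_eq_self (fun z => ‖fderiv ℝ F z‖)]
  simp [mul_comm]

lemma norm_phase_sub_one_le (θ : ℝ) (hθ : 0 < θ) (w z : Plane) :
    ‖phase θ w z - 1‖ ≤ 4 / θ * (‖w‖ * ‖z‖) := by
  have h1 : -(2 * I * (form θ w z : ℂ)) = I * ((-(2 * form θ w z) : ℝ) : ℂ) := by
    push_cast; ring
  rw [phase, h1]
  refine (Real.norm_exp_I_mul_ofReal_sub_one_le).trans ?_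
  have h2 : ∀ (x : Plane) (i : Fin 2), |x i| ≤ ‖x‖ := fun x i => PiLp.norm_apply_le x i
  have h3 : |w 1 * z 0 - w 0 * z 1| ≤ 2 * (‖w‖ * ‖z‖) := by
    refine (abs_sub _ _).trans ?_
    rw [abs_mul, abs_mul, two_mul]
    gcongr <;> exact h2 _ _
  rw [norm_neg, Real.norm_eq_abs, abs_mul, abs_two, form, abs_div, abs_of_pos hθ]
  calc 2 * (|w 1 * z 0 - w 0 * z 1| / θ) ≤ 2 * (2 * (‖w‖ * ‖z‖) / θ) := by gcongr
    _ = _ := by ring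

/-- Expand `L(b)ψ` in Weyl translates `W_w ψ`. Since the transform of `b` has mean zero, the
coefficient `⟪L(a)ψ, W_w ψ⟫` may be replaced by its increment from `w = 0`. That increment is
controlled by the twisted L¹ modulus of continuity of the transform of `a`, hence is linear in
`|w|`; what remains of `b` is the first moment of its transform. -/
lemma inner_leftMul_leftMul_le (θ : ℝ) (hθ : θ ≠ 0) (a b : 𝓢(Plane, ℂ)) (K : ℝ)
    (hb : ∫ w, symplFourier θ hθ b w = 0)
    (hK : ∀ w, ∫ z, ‖symplFourier θ hθ a (z + w) * phase θ w z - symplFourier θ hθ a z‖ ≤ K * ‖w‖)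
    (ψ : L2) :
    ‖inner ℂ (leftMul θ a ψ) (leftMul θ b ψ)‖ ≤
      (((Real.pi * θ) ^ 2)⁻¹ ^ 2 * K * ∫ w, ‖symplFourier θ hθ b w‖ * ‖w‖) * ‖ψ‖ ^ 2 := by
  set A := symplFourier θ hθ a
  set B := symplFourier θ hθ b
  set c : ℝ := ((Real.pi * θ) ^ 2)⁻¹
  have hc0 : 0 ≤ c := by positivity
  have hBw : Integrable fun w => ‖B w‖ * ‖w‖ := by
    simpa [mul_comm] using B.integrable_pow_mul volume 1
  -- the increments of the matrix coefficient
  have hinc : ∀ w, ‖inner ℂ (leftMul θ a ψ) (weyl θ w ψ) - inner ℂ (leftMul θ a ψ) ψ‖ ≤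
      c * (K * ‖w‖) * ‖ψ‖ ^ 2 := by
    intro w
    -- Conjugation moves `L(a)ψ` to the right-hand slot, where the Weyl expansion of `L(a)` applies.
    rw [← RCLike.norm_conj, map_sub, inner_conj_symm, inner_conj_symm, inner_leftMul θ hθ,
      inner_leftMul θ hθ, ← mul_sub]
    have hphase : Continuous fun z => phase θ w z :=
      (continuous_phase θ).comp (by fun_prop : Continuous fun z : Plane => (w, z))
    have hAw : Integrable fun z => A (z + w) * phase θ w z :=
      (A.integrable.comp_add_right w).mul_bdd (c := 1) hphase.aestronglyMeasurable
        (Filter.Eventually.of_forall fun z => (norm_phase θ w z).le)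
    have hshift : ∫ z, A z * inner ℂ (weyl θ w ψ) (weyl θ z ψ) =
        ∫ z, (A (z + w) * phase θ w z) * inner ℂ ψ (weyl θ z ψ) := by
      rw [← integral_add_right_eq_self (fun z => A z * inner ℂ (weyl θ w ψ) (weyl θ z ψ)) w]
      refine integral_congr_ae (Filter.Eventually.of_forall fun z => ?_)
      simp only [inner_weyl_weyl, add_sub_cancel_right, phase_add_right, phase_self, mul_one,
        mul_assoc]
    rw [hshift, ← integral_sub (integrable_mul_inner_weyl θ ψ ψ hAw)
      (integrable_mul_inner_weyl θ ψ ψ A.integrable), norm_mul, Complex.norm_real,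
      Real.norm_of_nonneg hc0, mul_assoc]
    gcongr
    calc ‖∫ z, (A (z + w) * phase θ w z * inner ℂ ψ (weyl θ z ψ) - A z * inner ℂ ψ (weyl θ z ψ))‖
        ≤ ∫ z, ‖A (z + w) * phase θ w z - A z‖ * ‖ψ‖ ^ 2 := by
          refine norm_integral_le_of_norm_le ((hAw.sub A.integrable).norm.mul_const _)
            (Filter.Eventually.of_forall fun z => ?_)
          rw [← sub_mul, norm_mul, sq]
          exact mul_le_mul_of_nonneg_left (norm_inner_weyl_le θ ψ ψ z) (norm_nonneg _)
      _ ≤ K * ‖w‖ * ‖ψ‖ ^ 2 := by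
          rw [integral_mul_const]
          gcongr
          exact hK w
  have hzero : ∫ w, B w * inner ℂ (leftMul θ a ψ) ψ = 0 := by rw [integral_mul_const, hb, zero_mul]
  rw [inner_leftMul θ hθ, ← sub_zero (∫ z, _), ← hzero,
    ← integral_sub (integrable_mul_inner_weyl θ _ ψ B.integrable) (B.integrable.mul_const _),
    norm_mul, Complex.norm_real, Real.norm_of_nonneg hc0]
  calc c * ‖∫ w, (B w * inner ℂ (leftMul θ a ψ) (weyl θ w ψ) - B w * inner ℂ (leftMul θ a ψ) ψ)‖
      ≤ c * ∫ w, (‖B w‖ * ‖w‖) * (c * K * ‖ψ‖ ^ 2) := by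
        gcongr
        refine norm_integral_le_of_norm_le (hBw.mul_const _)
          (Filter.Eventually.of_forall fun w => ?_)
        rw [← mul_sub, norm_mul, mul_assoc]
        gcongr
        exact (hinc w).trans_eq (by ring)
    _ = _ := by rw [integral_mul_const]; ring

/-- A sum of `N` operators `L(a_k)` whose Fourier transforms are the dyadic dilates of a Schwartz
function of mean zero has norm `O(√N)`. -/
lemma exists_norm_sum_dilates_le (θ : ℝ) (hθ : 0 < θ) (F : 𝓢(Plane, ℂ)) (hF : ∫ z, F z = 0)
    (a : ℕ → 𝓢(Plane, ℂ)) (ha : ∀ k z, symplFourier θ hθ.ne' (a k) z =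
      ((4 : ℝ) ^ k : ℝ) * F ((2 : ℝ) ^ k • z)) :
    ∃ C : ℝ, 0 ≤ C ∧ ∀ N : ℕ, ‖leftMul θ (∑ k ∈ Finset.range N, a k)‖ ≤ C * Real.sqrt N := by
  set C₁ := ∫ z, ‖fderiv ℝ F z‖ with hC₁
  set C₂ := ∫ z, ‖F z‖ * ‖z‖ with hC₂
  have h₁ : 0 ≤ C₁ := integral_nonneg fun _ => norm_nonneg _
  have h₂ : 0 ≤ C₂ := integral_nonneg fun _ => by positivity
  -- The factor `4^k` is the inverse of the Jacobian of dilation by `2^k` in the plane.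
  have hscale : ∀ (k : ℕ) (g : Plane → ℝ), ∫ z, (4 : ℝ) ^ k * g ((2 : ℝ) ^ k • z) = ∫ z, g z := by
    intro k g
    rw [integral_const_mul, Measure.integral_comp_smul, finrank_euclideanSpace_fin, smul_eq_mul,
      abs_of_nonneg (by positivity), ← mul_assoc, ← pow_mul, mul_comm k 2, pow_mul]
    norm_num
  have hmean : ∀ k, ∫ z, symplFourier θ hθ.ne' (a k) z = 0 := by
    intro k
    simp only [ha]
    rw [integral_const_mul, Measure.integral_comp_smul, hF]
    simp
  have hmom : ∀ k, ∫ z, ‖symplFourier θ hθ.ne' (a k) z‖ * ‖z‖ = (1 / 2) ^ k * C₂ := by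
    intro k
    rw [hC₂, ← hscale k (fun z => ‖F z‖ * ‖z‖), ← integral_const_mul]
    refine integral_congr_ae (Filter.Eventually.of_forall fun z => ?_)
    simp only [ha, norm_mul, Complex.norm_real, norm_smul]
    rw [Real.norm_of_nonneg (by positivity), Real.norm_of_nonneg (by positivity), one_div, inv_pow]
    field_simp
  have hmod : ∀ k w, ∫ z, ‖symplFourier θ hθ.ne' (a k) (z + w) * phase θ w z -
      symplFourier θ hθ.ne' (a k) z‖ ≤ (2 ^ k * (C₁ + 4 / θ * C₂)) * ‖w‖ := by
    intro k w
    set A := symplFourier θ hθ.ne' (a k) with hA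
    have hAw : Integrable fun z => ‖A z‖ * ‖z‖ := by
      simpa [mul_comm] using A.integrable_pow_mul volume 1
    have hb1 : ∫ z, ‖A (z + w) - A z‖ ≤ 2 ^ k * ‖w‖ * C₁ := by
      have := integral_norm_translate_sub_le F ((2 : ℝ) ^ k • w)
      rw [norm_smul, Real.norm_of_nonneg (by positivity), ← hscale k] at this
      refine le_trans (le_of_eq ?_) this
      refine integral_congr_ae (Filter.Eventually.of_forall fun z => ?_)
      simp only [hA, ha, ← mul_sub, norm_mul, Complex.norm_real, smul_add]
      rw [Real.norm_of_nonneg (by positivity)]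
    have hb2 : ∀ z, ‖A (z + w) * phase θ w z - A z‖ ≤
        ‖A (z + w) - A z‖ + 4 / θ * ‖w‖ * (‖A z‖ * ‖z‖) := by
      intro z
      -- The increment of `A` and the increment of the phase are treated separately; the latter is
      -- linear in `|w|` at the price of one moment of `A`.
      have : A (z + w) * phase θ w z - A z =
          (A (z + w) - A z) * phase θ w z + A z * (phase θ w z - 1) := by ring
      rw [this]
      refine (norm_add_le _ _).trans ?_
      rw [norm_mul, norm_mul, norm_phase, mul_one]
      have := mul_le_mul_of_nonneg_left (norm_phase_sub_one_le θ hθ w z) (norm_nonneg (A z))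
      linarith
    have hi1 : Integrable fun z => ‖A (z + w) - A z‖ :=
      ((A.integrable.comp_add_right w).sub A.integrable).norm
    calc ∫ z, ‖A (z + w) * phase θ w z - A z‖
        ≤ ∫ z, (‖A (z + w) - A z‖ + 4 / θ * ‖w‖ * (‖A z‖ * ‖z‖)) :=
          integral_mono_of_nonneg (Filter.Eventually.of_forall fun _ => norm_nonneg _)
            (hi1.add (hAw.const_mul _)) (Filter.Eventually.of_forall hb2)
      _ = (∫ z, ‖A (z + w) - A z‖) + 4 / θ * ‖w‖ * ((1 / 2) ^ k * C₂) := by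
          rw [integral_add hi1 (hAw.const_mul _), integral_const_mul, hmom]
      -- The crude bound `(1/2)^k ≤ 2^k` lets both contributions share the factor `2^k`.
      _ ≤ 2 ^ k * ‖w‖ * C₁ + 4 / θ * ‖w‖ * (2 ^ k * C₂) := by
          gcongr
          norm_num
      _ = _ := by ring
  set D := ((Real.pi * θ) ^ 2)⁻¹ ^ 2 * ((C₁ + 4 / θ * C₂) * C₂) with hD
  have hD0 : 0 ≤ D := by positivity
  refine ⟨Real.sqrt (3 * D), Real.sqrt_nonneg _, fun N => ?_⟩
  refine ContinuousLinearMap.opNorm_le_bound _ (by positivity) fun ψ => ?_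
  -- The modulus of continuity at scale `k` is of order `2^k` and the first moment at scale `l` is
  -- of order `2^{-l}`, so their product decays like `2^{-(l-k)}`.
  have horth := norm_sq_sum_le_of_almost_orthogonal (fun k => leftMul θ (a k) ψ) (D * ‖ψ‖ ^ 2)
    (fun k l hkl => by
      refine (inner_leftMul_leftMul_le θ hθ.ne' (a k) (a l) _ (hmean l) (hmod k) ψ).trans_eq ?_
      rw [hmom]
      obtain ⟨j, rfl⟩ := Nat.exists_eq_add_of_le hkl
      have h2 : (2 : ℝ) ^ k * (1 / 2) ^ k = 1 := by rw [← mul_pow]; norm_num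
      rw [Nat.add_sub_cancel_left, pow_add, hD]
      linear_combination (((Real.pi * θ) ^ 2)⁻¹ ^ 2 * ((C₁ + 4 / θ * C₂) * C₂)) *
        (1 / 2) ^ j * ‖ψ‖ ^ 2 * h2) N
  rw [← leftMulLinear_apply θ hθ.ne', map_sum, sum_apply]
  refine le_of_sq_le_sq ?_ (by positivity)
  refine horth.trans_eq ?_
  rw [mul_pow, mul_pow, Real.sq_sqrt (by positivity), Real.sq_sqrt (by positivity)]
  ring

section

open LineDeriv

/-! ### Differentiation of Moyal products -/

/-- The linear form `x ↦ x Θ⁻¹ z`. -/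
def formCLM (θ : ℝ) (z : Plane) : Plane →L[ℝ] ℝ :=
  θ⁻¹ • (z 0 • EuclideanSpace.proj 1 - z 1 • EuclideanSpace.proj 0)

lemma formCLM_apply (θ : ℝ) (x z : Plane) : formCLM θ z x = form θ x z := by
  simp [formCLM, form]; ring

lemma continuous_formCLM (θ : ℝ) : Continuous (formCLM θ) := by
  unfold formCLM; fun_prop

lemma norm_formCLM_le (θ : ℝ) (z : Plane) : ‖formCLM θ z‖ ≤ 2 * |θ|⁻¹ * ‖z‖ := by
  refine ContinuousLinearMap.opNorm_le_bound _ (by positivity) fun x => ?_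
  have h2 : ∀ (x : Plane) (i : Fin 2), |x i| ≤ ‖x‖ := fun x i => PiLp.norm_apply_le x i
  have h3 : |x 1 * z 0 - x 0 * z 1| ≤ 2 * (‖x‖ * ‖z‖) := by
    refine (abs_sub _ _).trans ?_
    rw [abs_mul, abs_mul, two_mul]
    gcongr <;> exact h2 _ _
  rw [formCLM_apply, form, Real.norm_eq_abs, abs_div, div_eq_inv_mul]
  calc |θ|⁻¹ * |x 1 * z 0 - x 0 * z 1| ≤ |θ|⁻¹ * (2 * (‖x‖ * ‖z‖)) := by gcongr
    _ = _ := by ring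

/-- The derivative of `x ↦ phase θ x z`. -/
def phaseDeriv (θ : ℝ) (x z : Plane) : Plane →L[ℝ] ℂ :=
  (phase θ x z * -(2 * I)) • (Complex.ofRealCLM.comp (formCLM θ z))

lemma phaseDeriv_apply (θ : ℝ) (x z m : Plane) :
    phaseDeriv θ x z m = -(2 * I * (form θ m z : ℂ)) * phase θ x z := by
  simp only [phaseDeriv, smul_apply, ContinuousLinearMap.comp_apply, formCLM_apply,
    Complex.ofRealCLM_apply, smul_eq_mul]
  ring

lemma norm_phaseDeriv_le (θ : ℝ) (x z : Plane) : ‖phaseDeriv θ x z‖ ≤ 4 * |θ|⁻¹ * ‖z‖ := by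
  rw [phaseDeriv, norm_smul, norm_mul, norm_phase, one_mul, norm_neg, norm_mul, Complex.norm_I,
    Complex.norm_ofNat, mul_one]
  have h : ‖Complex.ofRealCLM.comp (formCLM θ z)‖ ≤ 2 * |θ|⁻¹ * ‖z‖ := by
    refine (ContinuousLinearMap.opNorm_comp_le _ _).trans ?_
    rw [Complex.ofRealCLM_norm, one_mul]
    exact norm_formCLM_le θ z
  linarith

lemma hasFDerivAt_phase (θ : ℝ) (x z : Plane) :
    HasFDerivAt (fun y => phase θ y z) (phaseDeriv θ x z) x := by
  have h1 : HasFDerivAt (fun y => -(2 * I) * (formCLM θ z y : ℂ))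
      (-(2 * I) • (Complex.ofRealCLM.comp (formCLM θ z))) x :=
    (Complex.ofRealCLM.comp (formCLM θ z)).hasFDerivAt.const_mul (-(2 * I))
  have h2 := h1.cexp
  have h3 : (fun y => phase θ y z) = fun y => cexp (-(2 * I) * (formCLM θ z y : ℂ)) := by
    ext y; rw [formCLM_apply, phase]; congr 1; ring
  rw [phaseDeriv, mul_smul, congrFun h3 x, h3]
  exact h2

/-- Uniform domination for `x` near `x₀`: the inequality `1 + |z| ≤ (1 + |z - x|)(2 + |x₀|)`
transfers Schwartz decay from `z - x` to `z`. Of the three powers, one pays for the linear growth of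
the derivative of the phase and two leave a square integrable function on the plane. -/
lemma exists_translate_bound {E : Type*} [NormedAddCommGroup E] [NormedSpace ℝ E]
    (B : 𝓢(Plane, E)) (x₀ : Plane) :
    ∃ K : ℝ, 0 ≤ K ∧ ∀ x ∈ Metric.ball x₀ 1, ∀ z, ‖B (z - x)‖ ≤ K * ((1 + ‖z‖) ^ 3)⁻¹ := by
  set M : ℝ := 2 ^ 3 * (Finset.Iic ((3, 0) : ℕ × ℕ)).sup (fun m => SchwartzMap.seminorm ℝ m.1 m.2) B
    with hM
  have hB : ∀ y, (1 + ‖y‖) ^ 3 * ‖B y‖ ≤ M := by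
    intro y
    have := SchwartzMap.one_add_le_sup_seminorm_apply (𝕜 := ℝ) (m := (3, 0)) (k := 3) (n := 0)
      le_rfl le_rfl B y
    rwa [norm_iteratedFDeriv_zero] at this
  have hM0 : 0 ≤ M := le_trans (by positivity) (hB 0)
  refine ⟨M * (2 + ‖x₀‖) ^ 3, by positivity, fun x hx z => ?_⟩
  rw [← div_eq_mul_inv, le_div_iff₀ (by positivity)]
  have hx' : ‖x‖ ≤ 1 + ‖x₀‖ := by
    have h1 := norm_le_norm_add_norm_sub' x x₀
    have h2 : ‖x - x₀‖ < 1 := by simpa [dist_eq_norm] using hx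
    linarith
  have hz : 1 + ‖z‖ ≤ (1 + ‖z - x‖) * (2 + ‖x₀‖) := by
    have h1 := norm_le_norm_add_norm_sub' z x
    nlinarith [norm_nonneg (z - x), norm_nonneg x₀, norm_nonneg x]
  calc ‖B (z - x)‖ * (1 + ‖z‖) ^ 3
      ≤ ‖B (z - x)‖ * ((1 + ‖z - x‖) * (2 + ‖x₀‖)) ^ 3 := by gcongr
    _ = ((1 + ‖z - x‖) ^ 3 * ‖B (z - x)‖) * (2 + ‖x₀‖) ^ 3 := by ring
    _ ≤ _ := by gcongr; exact hB _

lemma memLp_inv_one_add_norm_sq :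
    MemLp (fun z : Plane => ((1 + ‖z‖) ^ 2)⁻¹) 2 volume := by
  have hc : Continuous fun z : Plane => ((1 + ‖z‖) ^ 2)⁻¹ :=
    (by fun_prop : Continuous fun z : Plane => (1 + ‖z‖) ^ 2).inv₀ fun z => by positivity
  rw [memLp_two_iff_integrable_sq hc.aestronglyMeasurable]
  have h := integrable_one_add_norm (E := Plane) (μ := volume) (r := 4)
    (by rw [finrank_euclideanSpace_fin]; norm_num)
  refine h.congr (Filter.Eventually.of_forall fun z => ?_)
  have : 0 ≤ 1 + ‖z‖ := by positivity
  simp only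
  rw [Real.rpow_neg this, inv_pow, ← pow_mul]
  congr 1
  exact_mod_cast Real.rpow_natCast (1 + ‖z‖) 4

/-- Moves `x` away from `ψ`, so that differentiating under the integral sign touches only the phase
and a Schwartz function. -/
lemma moyalStar_eq_integral_sub (θ : ℝ) (hθ : θ ≠ 0) (a : 𝓢(Plane, ℂ)) (ψ : Plane → ℂ)
    (x : Plane) : moyalStar θ a ψ x = (((Real.pi * θ) ^ 2)⁻¹ : ℝ) *
      ∫ z, phase θ x (-z) * symplFourier θ hθ a (z - x) * ψ z := by
  rw [moyalStar_eq θ hθ,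
    ← integral_add_left_eq_self (fun z => phase θ x (-z) * symplFourier θ hθ a (z - x) * ψ z) x]
  congr 2
  ext z
  rw [phase_neg_right, phase_add_right, ← phase_neg_right θ x x, add_sub_cancel_left]
  have := phase_add_right θ x x (-x)
  rw [phase_self, one_mul, add_neg_cancel, phase_zero_right] at this
  rw [← this, one_mul]

lemma integrable_schwartz_mul (B : 𝓢(Plane, ℂ)) (x : Plane) {g ψ : Plane → ℂ}
    (hg : Continuous g) (hg1 : ∀ z, ‖g z‖ ≤ 1) (hψ : MemLp ψ 2 volume) :
    Integrable fun z => g z * B z * ψ (x + z) := by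
  have h1 : MemLp (fun z => g z * B z) 2 volume := by
    refine (B.memLp 2 volume).of_le (hg.mul B.continuous).aestronglyMeasurable
      (Filter.Eventually.of_forall fun z => ?_)
    rw [norm_mul]
    exact mul_le_of_le_one_left (norm_nonneg _) (hg1 z)
  exact h1.integrable_mul (hψ.comp_measurePreserving (measurePreserving_add_left volume x))

/-- Integration by parts for the twisted convolution integrals. -/
lemma integral_phase_mul_fderiv (θ : ℝ) (A : 𝓢(Plane, ℂ)) {ψ : Plane → ℂ}
    (hd : ContDiff ℝ 1 ψ) (hψ : MemLp ψ 2 volume)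
    (hψ' : ∀ m, MemLp (fun w => fderiv ℝ ψ w m) 2 volume) (x m : Plane) :
    ∫ z, phase θ z x * A z * fderiv ℝ ψ (x + z) m =
      -((∫ z, phase θ z x * (∂_{m} A : 𝓢(Plane, ℂ)) z * ψ (x + z)) +
        -(2 * I * (form θ m x : ℂ)) * ∫ z, phase θ z x * A z * ψ (x + z)) := by
  have hpc : Continuous fun z => phase θ z x :=
    (continuous_phase θ).comp (by fun_prop : Continuous fun z : Plane => (z, x))
  have hfd : ∀ z, HasFDerivAt (fun z => phase θ z x * A z)
      (phase θ z x • fderiv ℝ A z + A z • phaseDeriv θ z x) z :=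
    fun z => (hasFDerivAt_phase θ z x).mul (A.hasFDerivAt z)
  have hfm : ∀ z, fderiv ℝ (fun z => phase θ z x * A z) z m =
      phase θ z x * (∂_{m} A : 𝓢(Plane, ℂ)) z +
      -(2 * I * (form θ m x : ℂ)) * (phase θ z x * A z) := by
    intro z
    rw [(hfd z).fderiv, add_apply, smul_apply, smul_apply, phaseDeriv_apply,
      SchwartzMap.lineDerivOp_apply_eq_fderiv, smul_eq_mul, smul_eq_mul]
    ring
  have hg1 : ∀ z, ‖phase θ z x‖ ≤ 1 := fun z => (norm_phase θ z x).le
  have hshift : ∀ z, HasFDerivAt (fun z => ψ (x + z)) (fderiv ℝ ψ (x + z)) z := by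
    intro z
    exact ((hd.differentiable one_ne_zero (x + z)).hasFDerivAt.comp z
      ((hasFDerivAt_id z).const_add x)).congr_fderiv (by ext; simp)
  have hi1 := integrable_schwartz_mul A x hpc hg1 hψ
  have hi2 := integrable_schwartz_mul (∂_{m} A) x hpc hg1 hψ
  have hi3 := integrable_schwartz_mul A x hpc hg1 (hψ' m)
  have hparts := integral_mul_fderiv_eq_neg_fderiv_mul_of_integrable
    (μ := (volume : Measure Plane)) (f := fun z => phase θ z x * A z)
    (g := fun z => ψ (x + z)) (v := m)
    (by
      refine (hi2.add (hi1.const_mul (-(2 * I * (form θ m x : ℂ))))).congr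
        (Filter.Eventually.of_forall fun z => ?_)
      simp only [Pi.add_apply, hfm]; ring)
    (by
      refine hi3.congr (Filter.Eventually.of_forall fun z => ?_)
      simp only [(hshift z).fderiv])
    hi1 (fun z _ => (hfd z).differentiableAt) (fun z _ => (hshift z).differentiableAt)
  simp only [(hshift _).fderiv, hfm] at hparts
  rw [hparts, ← integral_const_mul, ← integral_add hi2 (hi1.const_mul _)]
  congr 1
  refine integral_congr_ae (Filter.Eventually.of_forall fun z => ?_)
  simp only
  ring

/-- The Leibniz rule for the Moyal product of a Schwartz function and an `H¹` function. -/
lemma moyalStar_leibniz (θ : ℝ) (hθ : θ ≠ 0) (a : 𝓢(Plane, ℂ)) {ψ : Plane → ℂ}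
    (hd : ContDiff ℝ 1 ψ) (hψ : MemLp ψ 2 volume)
    (hψ' : ∀ m, MemLp (fun w => fderiv ℝ ψ w m) 2 volume) (x₀ : Plane) :
    DifferentiableAt ℝ (moyalStar θ a ψ) x₀ ∧ ∀ m, fderiv ℝ (moyalStar θ a ψ) x₀ m =
      moyalStar θ (∂_{m} a : 𝓢(Plane, ℂ)) ψ x₀ + moyalStar θ a (fun w => fderiv ℝ ψ w m) x₀ := by
  set A := symplFourier θ hθ a with hA
  set c : ℂ := ((((Real.pi * θ) ^ 2)⁻¹ : ℝ) : ℂ) with hc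
  have hphase : ∀ x : Plane, Continuous fun z => phase θ x (-z) := fun x =>
    (continuous_phase θ).comp (by fun_prop : Continuous fun z : Plane => (x, -z))
  have hDA : Continuous (fderiv ℝ A) := (A.smooth 1).continuous_fderiv (by norm_num)
  set G' : Plane → Plane → (Plane →L[ℝ] ℂ) := fun x z =>
    ψ z • (phase θ x (-z) • (-(fderiv ℝ A (z - x))) + A (z - x) • phaseDeriv θ x (-z)) with hG'
  obtain ⟨K₁, hK₁, hb₁⟩ := exists_translate_bound A x₀
  obtain ⟨K₂, hK₂, hb₂⟩ := exists_translate_bound (SchwartzMap.fderivCLM ℝ Plane ℂ A) x₀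
  simp only [SchwartzMap.fderivCLM_apply] at hb₂
  have hderiv : ∀ x z, HasFDerivAt (fun y => phase θ y (-z) * A (z - y) * ψ z) (G' x z) x := by
    intro x z
    have h1 : HasFDerivAt (fun y => A (z - y)) (-(fderiv ℝ A (z - x))) x := by
      exact ((A.hasFDerivAt (z - x)).comp x ((hasFDerivAt_id x).const_sub z)).congr_fderiv
        (by ext; simp)
    exact ((hasFDerivAt_phase θ x (-z)).mul h1).mul_const (ψ z)
  have hbound : ∀ z, ∀ x ∈ Metric.ball x₀ 1, ‖G' x z‖ ≤
      ‖ψ z‖ * ((K₂ + K₁ * (4 * |θ|⁻¹)) * ((1 + ‖z‖) ^ 2)⁻¹) := by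
    intro z x hx
    rw [hG', norm_smul]
    gcongr
    refine (norm_add_le _ _).trans ?_
    rw [norm_smul, norm_smul, norm_phase, one_mul, norm_neg]
    have h1 : ‖fderiv ℝ A (z - x)‖ ≤ K₂ * ((1 + ‖z‖) ^ 2)⁻¹ := by
      refine (hb₂ x hx z).trans ?_
      gcongr
      · linarith [norm_nonneg z]
      · norm_num
    have h2 : ‖A (z - x)‖ * ‖phaseDeriv θ x (-z)‖ ≤
        (K₁ * ((1 + ‖z‖) ^ 3)⁻¹) * (4 * |θ|⁻¹ * (1 + ‖z‖)) := by
      gcongr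
      · exact hb₁ x hx z
      · refine (norm_phaseDeriv_le θ x (-z)).trans ?_
        rw [norm_neg]
        gcongr
        linarith
    refine (add_le_add h1 h2).trans_eq ?_
    have : (1 + ‖z‖) ≠ 0 := by positivity
    field_simp
  have hψm : MemLp (fun z => ‖ψ z‖) 2 volume := hψ.norm
  have hbint : Integrable fun z => ‖ψ z‖ * ((K₂ + K₁ * (4 * |θ|⁻¹)) * ((1 + ‖z‖) ^ 2)⁻¹) :=
    hψm.integrable_mul (memLp_inv_one_add_norm_sq.const_mul _)
  have hGm : AEStronglyMeasurable (G' x₀) volume := by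
    have hpd : Continuous fun z => phaseDeriv θ x₀ (-z) := by
      unfold phaseDeriv
      refine ((hphase x₀).mul continuous_const).smul ?_
      exact continuous_const.clm_comp ((continuous_formCLM θ).comp continuous_neg)
    refine hd.continuous.aestronglyMeasurable.smul (Continuous.aestronglyMeasurable ?_)
    exact ((hphase x₀).smul (hDA.comp (by fun_prop)).neg).add
      ((A.continuous.comp (by fun_prop)).smul hpd)
  have hint : ∀ x, Integrable fun z => phase θ x (-z) * A (z - x) * ψ z := by
    intro x
    have h1 : MemLp (fun z => phase θ x (-z) * A (z - x)) 2 volume := by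
      refine ((A.memLp 2 volume).comp_measurePreserving
        (measurePreserving_sub_right volume x)).of_le
        ((hphase x).mul (A.continuous.comp (by fun_prop))).aestronglyMeasurable
        (Filter.Eventually.of_forall fun z => ?_)
      rw [norm_mul, norm_phase, one_mul]; rfl
    exact h1.integrable_mul hψ
  have hmain := hasFDerivAt_integral_of_dominated_of_fderiv_le (μ := (volume : Measure Plane))
    (F := fun x z => phase θ x (-z) * A (z - x) * ψ z) (F' := G') (x₀ := x₀)
    (Metric.ball_mem_nhds x₀ one_pos)
    (Filter.Eventually.of_forall fun x => (hint x).1) (hint x₀) hGm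
    (Filter.Eventually.of_forall hbound) hbint
    (Filter.Eventually.of_forall fun z x _ => hderiv x z)
  have hmain' : HasFDerivAt (moyalStar θ a ψ) (c • ∫ z, G' x₀ z) x₀ := by
    have h : moyalStar θ a ψ = fun x => c * ∫ z, phase θ x (-z) * A (z - x) * ψ z := by
      ext x; exact moyalStar_eq_integral_sub θ hθ a ψ x
    rw [h]
    exact hmain.const_mul c
  refine ⟨hmain'.differentiableAt, fun m => ?_⟩
  have hGint : Integrable (G' x₀) :=
    hbint.mono' hGm (Filter.Eventually.of_forall fun z =>
      hbound z x₀ (Metric.mem_ball_self one_pos))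
  rw [hmain'.fderiv, smul_apply, ContinuousLinearMap.integral_apply hGint, moyalStar_eq θ hθ,
    moyalStar_eq θ hθ, ← hc, ← mul_add, smul_eq_mul]
  congr 1
  have hpc : Continuous fun z => phase θ z x₀ :=
    (continuous_phase θ).comp (by fun_prop : Continuous fun z : Plane => (z, x₀))
  have hg1 : ∀ z, ‖phase θ z x₀‖ ≤ 1 := fun z => (norm_phase θ z x₀).le
  have hi1 := integrable_schwartz_mul A x₀ hpc hg1 hψ
  have hi2 := integrable_schwartz_mul (∂_{m} A) x₀ hpc hg1 hψ
  have hi4 := integrable_schwartz_mul (symplFourier θ hθ (∂_{m} a)) x₀ hpc hg1 hψ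
  have e1 : ∀ z, phase θ (-x₀) z = phase θ z x₀ := fun z => (phase_swap θ z x₀).symm
  have hi5 : Integrable fun z => -(phase θ z x₀ * (∂_{m} A : 𝓢(Plane, ℂ)) z * ψ (x₀ + z) +
      -(2 * I * (form θ m x₀ : ℂ)) * (phase θ z x₀ * A z * ψ (x₀ + z))) :=
    (hi2.add (hi1.const_mul _)).neg
  simp only [e1]
  -- The term containing the derivative of `ψ` is integrated by parts and the other side is shifted
  -- by `x₀`; the identity then holds pointwise under the integral against `ψ (x₀ + z)`.
  rw [integral_phase_mul_fderiv θ A hd hψ hψ', ← integral_const_mul,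
    ← integral_add hi2 (hi1.const_mul _), ← integral_neg,
    ← integral_add_left_eq_self (fun z => G' x₀ z m) x₀,
    ← integral_add hi4 hi5]
  refine integral_congr_ae (Filter.Eventually.of_forall fun z => ?_)
  simp only [hG', smul_apply, add_apply, neg_apply, phaseDeriv_apply, add_sub_cancel_left,
    symplFourier_lineDerivOp, smul_eq_mul, SchwartzMap.lineDerivOp_apply_eq_fderiv, ← hA]
  have e3 : phase θ x₀ (-(x₀ + z)) = phase θ z x₀ := by
    rw [phase_neg_right, phase_add_right, e1, e1, phase_self, one_mul]
  have e4 : form θ m (-(x₀ + z)) = - form θ m x₀ - form θ m z := by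
    simp only [form, PiLp.neg_apply, PiLp.add_apply]; ring
  rw [e3, e4]
  push_cast
  ring

end

section

open LineDeriv

/-! ### The norm of the commutator with the Dirac operator -/

lemma IsDiracDomain.contDiff_apply {ψ : Spinor} (h : IsDiracDomain ψ) (i : Fin 2) :
    ContDiff ℝ 1 fun x => ψ x i :=
  (contDiff_piLp 2).1 (h.1.of_le (by simp)) i

lemma IsDiracDomain.memLp {ψ : Spinor} (h : IsDiracDomain ψ) : MemLp ψ 2 volume :=
  (h.2 0).of_le h.1.continuous.aestronglyMeasurable
    (Filter.Eventually.of_forall fun x => by rw [norm_iteratedFDeriv_zero])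

lemma IsDiracDomain.memLp_apply {ψ : Spinor} (h : IsDiracDomain ψ) (i : Fin 2) :
    MemLp (fun x => ψ x i) 2 volume :=
  h.memLp.of_le (h.contDiff_apply i).continuous.aestronglyMeasurable
    (Filter.Eventually.of_forall fun x => PiLp.norm_apply_le (ψ x) i)

lemma fderiv_spinor_apply {ψ : Spinor} {x : Plane} (h : DifferentiableAt ℝ ψ x) (m : Plane)
    (i : Fin 2) : fderiv ℝ ψ x m i = fderiv ℝ (fun y => ψ y i) x m := by
  have h1 := (PiLp.hasFDerivAt_apply (𝕜 := ℝ) 2 (ψ x) i).comp x h.hasFDerivAt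
  exact (congrArg (fun T : Plane →L[ℝ] ℂ => T m) h1.fderiv).symm

lemma IsDiracDomain.memLp_fderiv_apply {ψ : Spinor} (h : IsDiracDomain ψ) (i : Fin 2) (m : Plane) :
    MemLp (fun x => fderiv ℝ (fun y => ψ y i) x m) 2 volume := by
  refine ((h.2 1).norm.mul_const ‖m‖).of_le
    (((h.contDiff_apply i).continuous_fderiv one_ne_zero).clm_apply
      continuous_const).aestronglyMeasurable (Filter.Eventually.of_forall fun x => ?_)
  have hd : DifferentiableAt ℝ ψ x := h.1.differentiable (by simp) x
  rw [← fderiv_spinor_apply hd, norm_mul, norm_norm, norm_norm, norm_iteratedFDeriv_one]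
  exact (PiLp.norm_apply_le _ i).trans (ContinuousLinearMap.le_opNorm _ _)

lemma dirac_apply_zero (ψ : Spinor) (x : Plane) : dirac ψ x 0 =
    -I * (fderiv ℝ ψ x (EuclideanSpace.single 0 1) 1 +
      I * fderiv ℝ ψ x (EuclideanSpace.single 1 1) 1) := by
  simp [dirac, pauli, Fin.sum_univ_two]
  ring

lemma dirac_apply_one (ψ : Spinor) (x : Plane) : dirac ψ x 1 =
    -I * (fderiv ℝ ψ x (EuclideanSpace.single 0 1) 0 -
      I * fderiv ℝ ψ x (EuclideanSpace.single 1 1) 0) := by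
  simp [dirac, pauli, Fin.sum_univ_two]
  ring

lemma differentiableAt_rep (θ : ℝ) (hθ : θ ≠ 0) (a : 𝓢(Plane, ℂ)) {ψ : Spinor}
    (h : IsDiracDomain ψ) (x : Plane) : DifferentiableAt ℝ (rep θ a ψ) x :=
  (differentiableAt_piLp 2).2 fun i => (moyalStar_leibniz θ hθ a (h.contDiff_apply i)
    (h.memLp_apply i) (h.memLp_fderiv_apply i) x).1

lemma fderiv_rep_apply (θ : ℝ) (hθ : θ ≠ 0) (a : 𝓢(Plane, ℂ)) {ψ : Spinor}
    (h : IsDiracDomain ψ) (x m : Plane) (i : Fin 2) : fderiv ℝ (rep θ a ψ) x m i =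
      moyalStar θ (∂_{m} a : 𝓢(Plane, ℂ)) (fun w => ψ w i) x +
        moyalStar θ a (fun w => fderiv ℝ (fun y => ψ y i) w m) x := by
  rw [fderiv_spinor_apply (differentiableAt_rep θ hθ a h x)]
  exact (moyalStar_leibniz θ hθ a (h.contDiff_apply i)
    (h.memLp_apply i) (h.memLp_fderiv_apply i) x).2 m

/-- By Leibniz the terms in which `D` differentiates `ψ` cancel, leaving `-i σ^μ L(∂_μ a)`. The
matrices are off-diagonal with entries of modulus one, so component `i` sees only component `1 - i`
and the triangle inequality suffices. -/
lemma commutator_apply (θ : ℝ) (hθ : θ ≠ 0) (a : 𝓢(Plane, ℂ)) {ψ : Spinor}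
    (h : IsDiracDomain ψ) (x : Plane) (i : Fin 2) :
    ‖commutator θ a ψ x i‖ ≤ ∑ μ : Fin 2,
      ‖moyalStar θ (∂_{(EuclideanSpace.single μ 1 : Plane)} a : 𝓢(Plane, ℂ))
        (fun w => ψ w (1 - i)) x‖ := by
  have hd : ∀ w, DifferentiableAt ℝ ψ w := fun w => h.1.differentiable (by simp) w
  have hlin : ∀ (j : Fin 2) (c : ℂ), moyalStar θ a
      ((-I) • ((fun w => fderiv ℝ (fun y => ψ y j) w (EuclideanSpace.single 0 1)) +
        c • fun w => fderiv ℝ (fun y => ψ y j) w (EuclideanSpace.single 1 1))) x =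
      -I * (moyalStar θ a (fun w => fderiv ℝ (fun y => ψ y j) w (EuclideanSpace.single 0 1)) x +
        c * moyalStar θ a (fun w => fderiv ℝ (fun y => ψ y j) w (EuclideanSpace.single 1 1)) x) := by
    intro j c
    rw [moyalStar_smul, moyalStar_add θ a (h.memLp_fderiv_apply j _)
      ((h.memLp_fderiv_apply j _).const_smul c), moyalStar_smul]
    rfl
  rw [Fin.sum_univ_two]
  fin_cases i
  · have h1 : rep θ a (dirac ψ) x 0 = moyalStar θ a
        ((-I) • ((fun w => fderiv ℝ (fun y => ψ y 1) w (EuclideanSpace.single 0 1)) +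
        I • fun w => fderiv ℝ (fun y => ψ y 1) w (EuclideanSpace.single 1 1))) x := by
      change moyalStar θ a (fun w => dirac ψ w 0) x = _
      congr 1
      ext w
      simp only [dirac_apply_zero, fderiv_spinor_apply (hd w), Pi.smul_apply, Pi.add_apply,
        smul_eq_mul]
    have h2 : commutator θ a ψ x 0 = -I *
        (moyalStar θ (∂_{(EuclideanSpace.single 0 1 : Plane)} a : 𝓢(Plane, ℂ))
          (fun w => ψ w 1) x + I * moyalStar θ
            (∂_{(EuclideanSpace.single 1 1 : Plane)} a : 𝓢(Plane, ℂ)) (fun w => ψ w 1) x) := by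
      rw [commutator, Pi.sub_apply, PiLp.sub_apply, h1, hlin, dirac_apply_zero,
        fderiv_rep_apply θ hθ a h, fderiv_rep_apply θ hθ a h]
      ring
    simp only [Fin.zero_eta, h2, norm_mul, norm_neg, Complex.norm_I, one_mul, sub_zero]
    refine (norm_add_le _ _).trans_eq ?_
    rw [norm_mul, Complex.norm_I, one_mul]
  · have h1 : rep θ a (dirac ψ) x 1 = moyalStar θ a
        ((-I) • ((fun w => fderiv ℝ (fun y => ψ y 0) w (EuclideanSpace.single 0 1)) +
        (-I) • fun w => fderiv ℝ (fun y => ψ y 0) w (EuclideanSpace.single 1 1))) x := by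
      change moyalStar θ a (fun w => dirac ψ w 1) x = _
      congr 1
      ext w
      simp only [dirac_apply_one, fderiv_spinor_apply (hd w), Pi.smul_apply, Pi.add_apply,
        smul_eq_mul]
      ring
    have h2 : commutator θ a ψ x 1 = -I *
        (moyalStar θ (∂_{(EuclideanSpace.single 0 1 : Plane)} a : 𝓢(Plane, ℂ))
          (fun w => ψ w 0) x - I * moyalStar θ
            (∂_{(EuclideanSpace.single 1 1 : Plane)} a : 𝓢(Plane, ℂ)) (fun w => ψ w 0) x) := by
      rw [commutator, Pi.sub_apply, PiLp.sub_apply, h1, hlin, dirac_apply_one,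
        fderiv_rep_apply θ hθ a h, fderiv_rep_apply θ hθ a h]
      ring
    simp only [Fin.mk_one, h2, norm_mul, norm_neg, Complex.norm_I, one_mul, sub_self]
    refine (norm_sub_le _ _).trans_eq ?_
    rw [norm_mul, Complex.norm_I, one_mul]

lemma eLpNorm_moyalStar_le (θ : ℝ) (a : 𝓢(Plane, ℂ)) {ψ : Plane → ℂ} (hψ : MemLp ψ 2 volume) :
    eLpNorm (moyalStar θ a ψ) 2 volume ≤ ENNReal.ofReal ‖leftMul θ a‖ * eLpNorm ψ 2 volume := by
  have h1 : leftMul θ a (hψ.toLp ψ) = (memLp_moyalStar θ a hψ).toLp _ := by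
    refine Lp.ext ((coeFn_leftMul θ a _).trans ?_)
    rw [moyalStar_congr θ a hψ.coeFn_toLp]
    exact (MemLp.coeFn_toLp _).symm
  have h2 := (leftMul θ a).le_opNorm (hψ.toLp ψ)
  rw [h1, Lp.norm_toLp, Lp.norm_toLp] at h2
  rw [← ENNReal.ofReal_toReal hψ.2.ne, ← ENNReal.ofReal_mul (norm_nonneg _),
    ← ENNReal.ofReal_toReal (memLp_moyalStar θ a hψ).2.ne]
  exact ENNReal.ofReal_le_ofReal h2

/-- The spinor norm is at most the sum of the norms of its two components, each controlled by the
same sum over `μ`; this is the origin of the factor `2`. -/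
lemma commutatorNorm_le (θ : ℝ) (hθ : θ ≠ 0) (a : 𝓢(Plane, ℂ)) :
    commutatorNorm θ a ≤ ENNReal.ofReal (2 * ∑ μ : Fin 2,
      ‖leftMul θ (∂_{(EuclideanSpace.single μ 1 : Plane)} a)‖) := by
  refine iSup₂_le fun ψ h => ENNReal.div_le_of_le_mul ?_
  set b : Fin 2 → 𝓢(Plane, ℂ) := fun μ => ∂_{(EuclideanSpace.single μ 1 : Plane)} a with hb
  have h1 : ∀ x, ‖commutator θ a ψ x‖ ≤
      ‖(∑ p : Fin 2 × Fin 2, fun x => ‖moyalStar θ (b p.2) (fun w => ψ w (1 - p.1)) x‖) x‖ := by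
    intro x
    rw [Finset.sum_apply, Real.norm_of_nonneg (Finset.sum_nonneg fun _ _ => norm_nonneg _),
      Fintype.sum_prod_type]
    refine le_trans ?_ (Finset.sum_le_sum fun i _ => commutator_apply θ hθ a h x i)
    rw [EuclideanSpace.norm_eq, Fin.sum_univ_two, Fin.sum_univ_two]
    refine Real.sqrt_le_iff.2 ⟨by positivity, ?_⟩
    nlinarith [norm_nonneg (commutator θ a ψ x 0), norm_nonneg (commutator θ a ψ x 1)]
  have h2 : ∀ (i : Fin 2), eLpNorm (fun x => ψ x i) 2 volume ≤ eLpNorm ψ 2 volume := fun i =>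
    eLpNorm_mono fun x => PiLp.norm_apply_le (ψ x) i
  calc eLpNorm (commutator θ a ψ) 2 volume
      ≤ eLpNorm (∑ p : Fin 2 × Fin 2, fun x => ‖moyalStar θ (b p.2) (fun w => ψ w (1 - p.1)) x‖)
          2 volume := eLpNorm_mono h1
    _ ≤ ∑ p : Fin 2 × Fin 2,
          eLpNorm (fun x => ‖moyalStar θ (b p.2) (fun w => ψ w (1 - p.1)) x‖) 2 volume :=
        eLpNorm_sum_le (fun p _ => (memLp_moyalStar θ (b p.2) (h.memLp_apply _)).1.norm)
          (by norm_num)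
    _ ≤ ∑ p : Fin 2 × Fin 2, ENNReal.ofReal ‖leftMul θ (b p.2)‖ * eLpNorm ψ 2 volume := by
        refine Finset.sum_le_sum fun p _ => ?_
        rw [eLpNorm_norm]
        refine (eLpNorm_moyalStar_le θ (b p.2) (h.memLp_apply _)).trans ?_
        gcongr
        exact h2 _
    _ = _ := by
        rw [← Finset.sum_mul, Fintype.sum_prod_type]
        simp only [Finset.sum_const, Finset.card_univ, Fintype.card_fin]
        rw [← ENNReal.ofReal_sum_of_nonneg fun _ _ => norm_nonneg _, nsmul_eq_mul,
          ENNReal.ofReal_mul zero_le_two]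
        simp [hb]

end

section

open LineDeriv

/-! ### The functions `z̄^m exp (-b |x|²)` -/

/-- `z̄` as a real linear map. -/
def zbarCLM : Plane →L[ℝ] ℂ :=
  ((Real.sqrt 2 : ℂ)⁻¹) • (Complex.ofRealCLM.comp (EuclideanSpace.proj 0) -
    I • Complex.ofRealCLM.comp (EuclideanSpace.proj 1))

lemma zbarCLM_apply (x : Plane) : zbarCLM x = zbar x := by
  simp [zbarCLM, zbar, div_eq_inv_mul]

lemma zbar_hasTemperateGrowth : Function.HasTemperateGrowth zbar := by
  have : zbar = zbarCLM := funext fun x => (zbarCLM_apply x).symm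
  rw [this]
  exact zbarCLM.hasTemperateGrowth

lemma zbar_add (x y : Plane) : zbar (x + y) = zbar x + zbar y := by
  simp only [← zbarCLM_apply, map_add]

lemma zbar_sub (x y : Plane) : zbar (x - y) = zbar x - zbar y := by
  simp only [← zbarCLM_apply, map_sub]

lemma sqrt_two_mul_zbar (x : Plane) : (Real.sqrt 2 : ℂ) * zbar x = x 0 - I * x 1 := by
  have : (Real.sqrt 2 : ℂ) ≠ 0 := by
    exact_mod_cast (Real.sqrt_pos.2 zero_lt_two).ne'
  rw [zbar]
  field_simp

lemma sqrt_two_sq : (Real.sqrt 2 : ℂ) ^ 2 = 2 := by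
  rw [← Complex.ofReal_pow, Real.sq_sqrt zero_le_two, Complex.ofReal_ofNat]

/-- `x ↦ z̄^m exp (-b ‖x‖²)` as a Schwartz function. -/
def zbarPowGaussian (b : ℝ) (hb : 0 < b) (m : ℕ) : 𝓢(Plane, ℂ) :=
  (SchwartzMap.smulLeftCLM ℂ zbar)^[m] (gaussian b hb)

lemma zbarPowGaussian_succ (b : ℝ) (hb : 0 < b) (m : ℕ) (x : Plane) :
    zbarPowGaussian b hb (m + 1) x = zbar x * zbarPowGaussian b hb m x := by
  rw [zbarPowGaussian, Function.iterate_succ_apply',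
    SchwartzMap.smulLeftCLM_apply_apply zbar_hasTemperateGrowth, smul_eq_mul, zbarPowGaussian]

lemma zbarPowGaussian_apply (b : ℝ) (hb : 0 < b) (m : ℕ) (x : Plane) :
    zbarPowGaussian b hb m x = zbar x ^ m * gaussian b hb x := by
  induction m with
  | zero => simp [zbarPowGaussian]
  | succ m ih => rw [zbarPowGaussian_succ, ih, pow_succ']; ring

lemma fderiv_gaussian_apply (b : ℝ) (hb : 0 < b) (x m : Plane) :
    fderiv ℝ (gaussian b hb) x m = -(2 * b * ⟪x, m⟫_ℝ : ℝ) * gaussian b hb x := by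
  have h1 : HasFDerivAt (fun x : Plane => -b * ‖x‖ ^ 2) (-b • (2 • innerSL ℝ x)) x :=
    (hasStrictFDerivAt_norm_sq x).hasFDerivAt.const_mul (-b)
  have h2 := Complex.ofRealCLM.hasFDerivAt.comp x h1.exp
  have h3 : ⇑(gaussian b hb) = Complex.ofRealCLM ∘ fun x : Plane => Real.exp (-b * ‖x‖ ^ 2) := rfl
  rw [gaussian_apply, h3, h2.fderiv]
  simp
  ring

/-- The operator `∂₁ - i∂₂` is `√2 ∂_z`, which annihilates powers of `z̄`, so only the Gaussian is
differentiated. -/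
lemma fderiv_zbarPowGaussian (b : ℝ) (hb : 0 < b) (m : ℕ) (x : Plane) :
    fderiv ℝ (zbarPowGaussian b hb m) x (EuclideanSpace.single 0 1) -
      I * fderiv ℝ (zbarPowGaussian b hb m) x (EuclideanSpace.single 1 1) =
      -(2 * Real.sqrt 2 * b) * (zbar x * zbarPowGaussian b hb m x) := by
  have hz : HasFDerivAt zbar zbarCLM x := by
    have : zbar = zbarCLM := funext fun x => (zbarCLM_apply x).symm
    rw [this]
    exact zbarCLM.hasFDerivAt
  have h1 := (hz.pow m).mul ((gaussian b hb).hasFDerivAt x)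
  have h2 : ⇑(zbarPowGaussian b hb m) = fun x => zbar x ^ m * gaussian b hb x :=
    funext fun x => zbarPowGaussian_apply b hb m x
  have h0 := sqrt_two_mul_zbar x
  have e0 : zbarCLM (EuclideanSpace.single 0 1) = (Real.sqrt 2 : ℂ)⁻¹ := by simp [zbarCLM]
  have e1 : zbarCLM (EuclideanSpace.single 1 1) = -(Real.sqrt 2 : ℂ)⁻¹ * I := by simp [zbarCLM]
  have i0 : ⟪x, EuclideanSpace.single 0 1⟫_ℝ = x 0 := by
    rw [EuclideanSpace.inner_single_right]; simp
  have i1 : ⟪x, EuclideanSpace.single 1 1⟫_ℝ = x 1 := by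
    rw [EuclideanSpace.inner_single_right]; simp
  have h3 := h1.fderiv
  rw [show ((fun x => zbar x ^ m) * ⇑(gaussian b hb)) = ⇑(zbarPowGaussian b hb m) from h2.symm] at h3
  rw [h3, zbarPowGaussian_apply]
  simp only [add_apply, smul_apply, smul_eq_mul, fderiv_gaussian_apply, e0, e1, i0, i1]
  push_cast
  simp only [nsmul_eq_mul]
  linear_combination (-(2 * b * gaussian b hb x * zbar x ^ m)) * -h0 +
    (gaussian b hb x * (m * zbar x ^ (m - 1)) * (Real.sqrt 2 : ℂ)⁻¹) * Complex.I_sq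

/-! ### The functions `f_{m0}` -/

/-- Left Moyal multiplication by `z̄` is `z̄ - (θ/2) ∂_z`. -/
lemma starPoly_zbar (θ : ℝ) (hθ : θ ≠ 0) (b : 𝓢(Plane, ℂ)) (x : Plane) :
    starPoly θ zbar b x = zbar x * b x - θ / (2 * Real.sqrt 2) *
      (fderiv ℝ b x (EuclideanSpace.single 0 1) -
        I * fderiv ℝ b x (EuclideanSpace.single 1 1)) := by
  set B := symplFourier θ hθ b with hB
  set D₀ : 𝓢(Plane, ℂ) := ∂_{(EuclideanSpace.single 0 1 : Plane)} b with hD₀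
  set D₁ : 𝓢(Plane, ℂ) := ∂_{(EuclideanSpace.single 1 1 : Plane)} b with hD₁
  have hinner : ∀ y, ∫ z, b (x + z) * phase θ y z = phase θ (-x) (-y) * B (-y) := by
    intro y
    rw [← inner_integral]
    refine integral_congr_ae (Filter.Eventually.of_forall fun z => ?_)
    simp only
    rw [phase_neg_right, ← phase_swap]
  have hI : ∀ F : 𝓢(Plane, ℂ), Integrable fun y => phase θ (-x) y * F y := by
    intro F
    have hc : Continuous fun y => phase θ (-x) y :=
      (continuous_phase θ).comp (by fun_prop : Continuous fun y : Plane => (-x, y))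
    exact F.integrable.bdd_mul (c := 1) hc.aestronglyMeasurable
      (Filter.Eventually.of_forall fun y => (norm_phase θ _ _).le)
  -- On the transform side, multiplication by the linear function `z̄` is a combination of first
  -- derivatives of `b`.
  have hz : ∀ y, zbar y * B y = θ / (2 * Real.sqrt 2) *
      (symplFourier θ hθ D₀ y - I * symplFourier θ hθ D₁ y) := by
    intro y
    have f0 : form θ (EuclideanSpace.single 0 1) y = - y 1 / θ := by simp [form]
    have f1 : form θ (EuclideanSpace.single 1 1) y = y 0 / θ := by simp [form]
    rw [hD₀, hD₁, symplFourier_lineDerivOp, symplFourier_lineDerivOp, f0, f1, ← hB, zbar]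
    push_cast
    field_simp
    linear_combination (B y * y 0) * Complex.I_sq
  have hpt : ∀ y, zbar (x + -y) * (phase θ (-x) (- -y) * B (- -y)) =
      zbar x * (phase θ (-x) y * B y) - θ / (2 * Real.sqrt 2) *
        (phase θ (-x) y * symplFourier θ hθ D₀ y -
          I * (phase θ (-x) y * symplFourier θ hθ D₁ y)) := by
    intro y
    rw [neg_neg, ← sub_eq_add_neg, zbar_sub]
    linear_combination (-(phase θ (-x) y)) * hz y
  rw [starPoly]
  simp only [hinner]
  rw [← integral_neg_eq_self]
  simp only [hpt]
  have hI' : Integrable fun y => phase θ (-x) y * symplFourier θ hθ D₀ y -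
      I * (phase θ (-x) y * symplFourier θ hθ D₁ y) := (hI _).sub ((hI _).const_mul I)
  rw [integral_sub ((hI B).const_mul _) (hI'.const_mul _),
    integral_const_mul, integral_const_mul, integral_sub (hI _) ((hI _).const_mul _),
    integral_const_mul]
  have v := symplFourier_inversion θ hθ b x
  have v0 := symplFourier_inversion θ hθ D₀ x
  have v1 := symplFourier_inversion θ hθ D₁ x
  rw [hD₀, SchwartzMap.lineDerivOp_apply_eq_fderiv, ← hD₀] at v0
  rw [hD₁, SchwartzMap.lineDerivOp_apply_eq_fderiv, ← hD₁] at v1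
  rw [← v0, ← v1, ← v]
  ring

/-- With Gaussian exponent `1/θ`, the derivative term in `z̄ ⋆` reproduces `z̄` once more, so each
Moyal factor acts as ordinary multiplication by `2 z̄`; the remaining factor `2` comes from `f₀₀`.
-/
lemma iterate_starPoly_zbar (θ : ℝ) (hθ : 0 < θ) (m : ℕ) :
    (starPoly θ zbar)^[m] (f00 θ) =
      ⇑((2 : ℂ) ^ (m + 1) • zbarPowGaussian θ⁻¹ (inv_pos.2 hθ) m) := by
  induction m with
  | zero =>
    ext x
    have : -θ⁻¹ * ‖x‖ ^ 2 = -(2 * ((x 0 ^ 2 + x 1 ^ 2) / 2) / θ) := by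
      rw [EuclideanSpace.real_norm_sq_eq, Fin.sum_univ_two]; ring
    rw [Function.iterate_zero_apply, smul_apply, zbarPowGaussian_apply, gaussian_apply, this, f00]
    push_cast
    simp
  | succ m ih =>
    ext x
    have h := fderiv_zbarPowGaussian θ⁻¹ (inv_pos.2 hθ) m x
    have hd : ∀ v, fderiv ℝ (⇑((2 : ℂ) ^ (m + 1) • zbarPowGaussian θ⁻¹ (inv_pos.2 hθ) m)) x v =
        2 ^ (m + 1) * fderiv ℝ (zbarPowGaussian θ⁻¹ (inv_pos.2 hθ) m) x v := by
      intro v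
      have : ⇑((2 : ℂ) ^ (m + 1) • zbarPowGaussian θ⁻¹ (inv_pos.2 hθ) m) =
        fun y => (2 : ℂ) ^ (m + 1) * zbarPowGaussian θ⁻¹ (inv_pos.2 hθ) m y := rfl
      rw [this, ((SchwartzMap.hasFDerivAt _ x).const_mul _).fderiv]
      rfl
    rw [Function.iterate_succ_apply', ih, starPoly_zbar θ hθ.ne', hd, hd, mul_left_comm I, ← mul_sub,
      h, smul_apply, smul_apply, zbarPowGaussian_succ, smul_eq_mul, smul_eq_mul]
    push_cast
    field_simp
    ring

/-- The normalisation constant in `f_{m0} / √(2πθ) = const * z̄^m exp (-|x|²/θ)`. -/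
def baseConst (θ : ℝ) (m : ℕ) : ℝ :=
  (Real.sqrt (2 * Real.pi * θ))⁻¹ * (Real.sqrt (θ ^ m * (m.factorial : ℝ)))⁻¹ * 2 ^ (m + 1)

lemma baseVector_eq (θ : ℝ) (hθ : 0 < θ) (m : ℕ) : baseVector θ m =
    (baseConst θ m : ℂ) • (zbarPowGaussian θ⁻¹ (inv_pos.2 hθ) m).toLp 2 volume := by
  set g := zbarPowGaussian θ⁻¹ (inv_pos.2 hθ) m
  have h1 : matrixBase θ m =
      ⇑((((Real.sqrt (θ ^ m * (m.factorial : ℝ)))⁻¹ * 2 ^ (m + 1) : ℝ) : ℂ) • g) := by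
    rw [matrixBase, iterate_starPoly_zbar θ hθ]
    ext x
    simp only [Pi.smul_apply, smul_apply, smul_eq_mul]
    push_cast
    ring
  have h2 : toL2 (matrixBase θ m) =
      ((((Real.sqrt (θ ^ m * (m.factorial : ℝ)))⁻¹ * 2 ^ (m + 1) : ℝ) : ℂ) •
        g.toLp 2 volume : L2) := by
    rw [toL2, h1, dif_pos (SchwartzMap.memLp _ 2 volume)]
    rfl
  rw [baseVector, h2, smul_smul, baseConst]
  congr 1
  push_cast
  ring

end

section

open LineDeriv

/-! ### Eigenvectors of `L(exp (-b |x|²))` -/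

lemma contDiff_schwartz (F : 𝓢(Plane, ℂ)) : ContDiff ℝ 1 F := F.smooth 1

lemma memLp_fderiv_schwartz (F : 𝓢(Plane, ℂ)) (m : Plane) :
    MemLp (fun w => fderiv ℝ F w m) 2 volume :=
  (∂_{m} F : 𝓢(Plane, ℂ)).memLp 2 volume

/-- `∫ e^{2 i x Θ⁻¹ z} e^{-β|z|²} b_m(x + z) dz` for `b_m = z̄^m e^{-|x|²/θ}`. -/
lemma integral_gaussian_zbarPowGaussian (θ : ℝ) (hθ : 0 < θ) (β : ℝ) (hβ : 0 < β) (m : ℕ)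
    (x : Plane) : ∫ z, phase θ z x * gaussian β hβ z *
        zbarPowGaussian θ⁻¹ (inv_pos.2 hθ) m (x + z) =
      ((Real.pi / (β + θ⁻¹) * ((β - θ⁻¹) / (β + θ⁻¹)) ^ m : ℝ) : ℂ) *
        zbarPowGaussian θ⁻¹ (inv_pos.2 hθ) m x := by
  have hγ : 0 < β + θ⁻¹ := by positivity
  -- For `m = 0` one completes the square. For the step, `z̄ b_m` is a multiple of `(∂₁ - i∂₂) b_m`;
  -- integrating by parts onto the phase and the Gaussian gives `(β + θ⁻¹) J' = (β - θ⁻¹) z̄ J`.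
  induction m with
  | zero =>
    set γ := β + θ⁻¹ with hγdef
    have hexp : ∀ z : Plane, -β * ‖z‖ ^ 2 + -θ⁻¹ * ‖x + z‖ ^ 2 =
        -γ * ‖z + (θ⁻¹ / γ) • x‖ ^ 2 + (θ⁻¹ ^ 2 / γ - θ⁻¹) * ‖x‖ ^ 2 := by
      intro z
      simp only [EuclideanSpace.real_norm_sq_eq, Fin.sum_univ_two, PiLp.add_apply, PiLp.smul_apply,
        smul_eq_mul]
      have : β = γ - θ⁻¹ := by rw [hγdef]; ring
      rw [this]
      field_simp
      ring
    have h1 : ∀ z : Plane, phase θ z x * gaussian β hβ z *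
        zbarPowGaussian θ⁻¹ (inv_pos.2 hθ) 0 (x + z) =
        (Real.exp ((θ⁻¹ ^ 2 / γ - θ⁻¹) * ‖x‖ ^ 2) : ℂ) *
          (fun w => gaussian γ hγ w * phase θ w x) (z + (θ⁻¹ / γ) • x) := by
      intro z
      -- Completing the square shifts `z` along `x`, and the phase does not see this because the
      -- form is antisymmetric.
      have hp : phase θ (z + (θ⁻¹ / γ) • x) x = phase θ z x := by
        have : form θ ((θ⁻¹ / γ) • x) x = 0 := by
          simp only [form, PiLp.smul_apply, smul_eq_mul]; ring
        rw [phase_add_left]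
        nth_rewrite 2 [phase]
        rw [this]
        simp
      simp only [hp, zbarPowGaussian_apply, gaussian_apply, pow_zero, one_mul]
      rw [mul_assoc, ← Complex.ofReal_mul, ← Real.exp_add, hexp, Real.exp_add]
      push_cast
      ring
    simp only [h1]
    rw [integral_const_mul,
      integral_add_right_eq_self (fun w => gaussian γ hγ w * phase θ w x),
      ← symplFourier_apply θ hθ.ne', symplFourier_gaussian, zbarPowGaussian_apply, gaussian_apply,
      pow_zero, pow_zero, one_mul, mul_one, ← Complex.ofReal_mul, ← Complex.ofReal_mul,
      mul_left_comm, ← Real.exp_add]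
    congr 4
    field_simp
    ring
  | succ m ih =>
    set b := zbarPowGaussian θ⁻¹ (inv_pos.2 hθ) m with hb
    set J := ∫ z, phase θ z x * gaussian β hβ z * b (x + z) with hJ
    set J' := ∫ z, phase θ z x * gaussian β hβ z *
      zbarPowGaussian θ⁻¹ (inv_pos.2 hθ) (m + 1) (x + z) with hJ'
    set e₀ : Plane := EuclideanSpace.single 0 1 with he₀
    set e₁ : Plane := EuclideanSpace.single 1 1 with he₁
    have hpc : Continuous fun z => phase θ z x :=
      (continuous_phase θ).comp (by fun_prop : Continuous fun z : Plane => (z, x))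
    have hg1 : ∀ z, ‖phase θ z x‖ ≤ 1 := fun z => (norm_phase θ z x).le
    have hI : ∀ F G : 𝓢(Plane, ℂ), Integrable fun z => phase θ z x * F z * G (x + z) :=
      fun F G => integrable_schwartz_mul F x hpc hg1 (G.memLp 2 volume)
    have p₀ := integral_phase_mul_fderiv θ (gaussian β hβ) (contDiff_schwartz b)
      (b.memLp 2 volume) (memLp_fderiv_schwartz b) x e₀
    have p₁ := integral_phase_mul_fderiv θ (gaussian β hβ) (contDiff_schwartz b)
      (b.memLp 2 volume) (memLp_fderiv_schwartz b) x e₁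
    have hL : (∫ z, phase θ z x * gaussian β hβ z * fderiv ℝ b (x + z) e₀) -
        I * (∫ z, phase θ z x * gaussian β hβ z * fderiv ℝ b (x + z) e₁) =
        -(2 * Real.sqrt 2 * (θ⁻¹ : ℝ)) * J' := by
      have hD : ∀ v, Integrable fun z => phase θ z x * gaussian β hβ z * fderiv ℝ b (x + z) v :=
        fun v => hI _ (∂_{v} b)
      rw [← integral_const_mul, ← integral_sub (hD e₀) ((hD e₁).const_mul I), hJ',
        ← integral_const_mul]
      refine integral_congr_ae (Filter.Eventually.of_forall fun z => ?_)
      have := fderiv_zbarPowGaussian θ⁻¹ (inv_pos.2 hθ) m (x + z)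
      simp only [zbarPowGaussian_succ]
      linear_combination (phase θ z x * gaussian β hβ z) * this
    have hR : (∫ z, phase θ z x * (∂_{e₀} (gaussian β hβ) : 𝓢(Plane, ℂ)) z * b (x + z)) -
        I * (∫ z, phase θ z x * (∂_{e₁} (gaussian β hβ) : 𝓢(Plane, ℂ)) z * b (x + z)) =
        -(2 * Real.sqrt 2 * β) * (J' - zbar x * J) := by
      have hs : Integrable fun z => phase θ z x * gaussian β hβ z *
          zbarPowGaussian θ⁻¹ (inv_pos.2 hθ) (m + 1) (x + z) := hI _ _
      rw [← integral_const_mul, ← integral_sub (hI _ b) ((hI _ b).const_mul I), hJ', hJ,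
        ← integral_const_mul (zbar x), ← integral_sub hs ((hI _ b).const_mul _),
        ← integral_const_mul]
      refine integral_congr_ae (Filter.Eventually.of_forall fun z => ?_)
      have := fderiv_zbarPowGaussian β hβ 0 z
      have h0 : zbarPowGaussian β hβ 0 = gaussian β hβ := rfl
      rw [h0] at this
      simp only [zbarPowGaussian_succ, zbar_add, SchwartzMap.lineDerivOp_apply_eq_fderiv]
      linear_combination (phase θ z x * b (x + z)) * this
    have f0 : form θ e₀ x = - x 1 / θ := by simp [form, he₀]
    have f1 : form θ e₁ x = x 0 / θ := by simp [form, he₁]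
    have hz := sqrt_two_mul_zbar x
    have hs : (Real.sqrt 2 : ℂ) ≠ 0 := by
      exact_mod_cast (Real.sqrt_pos.2 zero_lt_two).ne'
    rw [f0] at p₀
    rw [f1] at p₁
    have hrec : ((β + θ⁻¹ : ℝ) : ℂ) * J' = ((β - θ⁻¹ : ℝ) : ℂ) * (zbar x * J) := by
      have h2 : (2 * Real.sqrt 2 : ℂ) ≠ 0 := mul_ne_zero two_ne_zero hs
      refine mul_left_cancel₀ h2 ?_
      push_cast at hL hR p₀ p₁ ⊢
      linear_combination hL + hR - p₀ + I * p₁ + 2 * (θ : ℂ)⁻¹ * J * hz +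
        2 * (θ : ℂ)⁻¹ * J * x 0 * Complex.I_sq
    have hγ' : ((β + θ⁻¹ : ℝ) : ℂ) ≠ 0 := by exact_mod_cast hγ.ne'
    refine mul_left_cancel₀ hγ' ?_
    rw [hrec, ih, zbarPowGaussian_succ, ← hb]
    push_cast at hγ' ⊢
    rw [pow_succ]
    field_simp

/-- The eigenvalue of `L(exp (-|x|²/(θ q)))` on `f_{m0}`. -/
def gaussEigenvalue (q : ℝ) (m : ℕ) : ℝ := q / (q + 1) * ((q - 1) / (q + 1)) ^ m

/-- The transform of this Gaussian is a Gaussian with exponent `β = q/θ`, and then `(β - θ⁻¹)/(β +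
θ⁻¹) = (q - 1)/(q + 1)`. -/
lemma leftMul_gaussian_baseVector (θ : ℝ) (hθ : 0 < θ) (q : ℝ) (hq : 0 < q) (m : ℕ) :
    leftMul θ (gaussian (θ * q)⁻¹ (by positivity)) (baseVector θ m) =
      (gaussEigenvalue q m : ℂ) • baseVector θ m := by
  have hb : 0 < (θ * q)⁻¹ := by positivity
  have hβ : 0 < q / θ := by positivity
  rw [baseVector_eq θ hθ, map_smul, smul_comm]
  congr 1
  refine Lp.ext ((coeFn_leftMul θ _ _).trans ?_)
  rw [moyalStar_congr θ _ (SchwartzMap.coeFn_toLp _ 2 volume)]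
  filter_upwards [Lp.coeFn_smul (gaussEigenvalue q m : ℂ)
    ((zbarPowGaussian θ⁻¹ (inv_pos.2 hθ) m).toLp 2 volume),
    SchwartzMap.coeFn_toLp (zbarPowGaussian θ⁻¹ (inv_pos.2 hθ) m) 2 volume] with x h1 h2
  rw [h1, Pi.smul_apply, h2, moyalStar_eq θ hθ.ne']
  have h3 : ∀ z, phase θ (-x) z * symplFourier θ hθ.ne' (gaussian (θ * q)⁻¹ hb) z *
      zbarPowGaussian θ⁻¹ (inv_pos.2 hθ) m (x + z) =
      ((Real.pi / (θ * q)⁻¹ : ℝ) : ℂ) * (phase θ z x * gaussian (q / θ) hβ z *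
        zbarPowGaussian θ⁻¹ (inv_pos.2 hθ) m (x + z)) := by
    intro z
    have e : (θ ^ 2 * (θ * q)⁻¹)⁻¹ = q / θ := by field_simp
    rw [symplFourier_gaussian, gaussian_apply, e, phase_swap θ z x]
    push_cast
    ring
  simp only [h3]
  rw [integral_const_mul, integral_gaussian_zbarPowGaussian θ hθ, smul_eq_mul, ← mul_assoc,
    ← mul_assoc, ← Complex.ofReal_mul, ← Complex.ofReal_mul, gaussEigenvalue]
  congr 2
  have e1 : q / θ + θ⁻¹ = (q + 1) / θ := by field_simp
  have e2 : q / θ - θ⁻¹ = (q - 1) / θ := by field_simp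
  rw [e1, e2, div_div_div_cancel_right₀ hθ.ne']
  have : q + 1 ≠ 0 := by positivity
  field_simp

/-- The transform is positive with integral `(πθ)²`, so the L¹ bound for `‖L(a)‖` equals exactly
`1`. -/
lemma norm_leftMul_gaussian_le (θ : ℝ) (hθ : 0 < θ) (b : ℝ) (hb : 0 < b) :
    ‖leftMul θ (gaussian b hb)‖ ≤ 1 := by
  refine (norm_leftMul_le θ hθ.ne' _).trans_eq ?_
  have h : ∀ z, ‖symplFourier θ hθ.ne' (gaussian b hb) z‖ =
      Real.pi / b * Real.exp (-(θ ^ 2 * b)⁻¹ * ‖z‖ ^ 2) := by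
    intro z
    have := Real.pi_pos
    rw [symplFourier_gaussian, Complex.norm_real, Real.norm_of_nonneg (by positivity)]
  simp only [h]
  rw [integral_const_mul, GaussianFourier.integral_rexp_neg_mul_sq_norm (by positivity),
    finrank_euclideanSpace_fin]
  norm_num
  field_simp

end

/-! ### The vectors `f_{m0} / √(2πθ)` are orthonormal -/

lemma integral_plane_eq (F : Plane → ℂ) :
    ∫ x, F x = ∫ w : ℂ, F (Complex.orthonormalBasisOneI.repr w) :=
  ((Complex.orthonormalBasisOneI.measurePreserving_repr).integral_comp
    Complex.orthonormalBasisOneI.repr.toHomeomorph.measurableEmbedding F).symm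

lemma zbar_repr (w : ℂ) :
    zbar (Complex.orthonormalBasisOneI.repr w) = (starRingEnd ℂ) w / (Real.sqrt 2 : ℂ) := by
  rw [zbar]
  congr 1
  apply Complex.ext <;> simp

/-- Rotation by the angle `π/(m - n)` preserves the measure and changes the sign of the integrand.
No integrability is required. -/
lemma integral_pow_mul_conj_pow_eq_zero {m n : ℕ} (hmn : m ≠ n) (G : ℝ → ℂ) :
    ∫ w : ℂ, w ^ m * (starRingEnd ℂ) w ^ n * G ‖w‖ = 0 := by
  set t : ℝ := Real.pi / ((m : ℝ) - n) with ht
  have h := ((rotation (Circle.exp t)).measurePreserving).integral_comp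
    (rotation (Circle.exp t)).toHomeomorph.measurableEmbedding
    (fun w : ℂ => w ^ m * (starRingEnd ℂ) w ^ n * G ‖w‖)
  have hne : ((m : ℂ) - n) ≠ 0 := sub_ne_zero.2 (by exact_mod_cast hmn)
  have hc : ∀ w : ℂ, (rotation (Circle.exp t) w) ^ m *
      (starRingEnd ℂ) (rotation (Circle.exp t) w) ^ n * G ‖rotation (Circle.exp t) w‖ =
      -(w ^ m * (starRingEnd ℂ) w ^ n * G ‖w‖) := by
    intro w
    have e : cexp (t * I) ^ m * (starRingEnd ℂ) (cexp (t * I)) ^ n = -1 := by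
      rw [← Complex.exp_conj, ← Complex.exp_nat_mul, ← Complex.exp_nat_mul, ← Complex.exp_add,
        ← Complex.exp_pi_mul_I]
      congr 1
      simp only [map_mul, Complex.conj_ofReal, Complex.conj_I, ht]
      push_cast
      field_simp
      ring
    rw [LinearIsometryEquiv.norm_map, rotation_apply, Circle.coe_exp, map_mul, mul_pow, mul_pow]
    linear_combination (w ^ m * (starRingEnd ℂ) w ^ n * G ‖w‖) * e
  simp only [hc] at h
  rw [integral_neg] at h
  exact self_eq_neg.1 h.symm

lemma inner_baseVector (θ : ℝ) (hθ : 0 < θ) (m n : ℕ) :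
    inner ℂ (baseVector θ m) (baseVector θ n) = (baseConst θ m : ℂ) * baseConst θ n *
      ∫ w : ℂ, w ^ m * (starRingEnd ℂ) w ^ n *
        (((Real.sqrt 2 : ℂ) ^ (m + n))⁻¹ * (Real.exp (-(2 / θ) * ‖w‖ ^ 2) : ℂ)) := by
  rw [baseVector_eq θ hθ, baseVector_eq θ hθ, inner_smul_left, inner_smul_right, Complex.conj_ofReal,
    ← mul_assoc]
  congr 1
  refine (SchwartzMap.inner_toL2_toL2_eq (zbarPowGaussian θ⁻¹ (inv_pos.2 hθ) m)
    (zbarPowGaussian θ⁻¹ (inv_pos.2 hθ) n) volume).trans ?_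
  rw [integral_plane_eq]
  refine integral_congr_ae (Filter.Eventually.of_forall fun w => ?_)
  simp only [RCLike.inner_apply, zbarPowGaussian_apply, gaussian_apply, zbar_repr,
    LinearIsometryEquiv.norm_map, map_mul, map_pow, map_div₀, Complex.conj_conj, Complex.conj_ofReal]
  have : Real.exp (-(2 / θ) * ‖w‖ ^ 2) =
      Real.exp (-θ⁻¹ * ‖w‖ ^ 2) * Real.exp (-θ⁻¹ * ‖w‖ ^ 2) := by
    rw [← Real.exp_add]; congr 1; ring
  rw [this, pow_add, div_pow, div_pow, mul_inv]
  push_cast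
  ring

/-- In polar form the squared norm is the Gamma integral `Γ(m + 1) = m!`, which the constants in
`baseConst` cancel. -/
lemma norm_baseVector (θ : ℝ) (hθ : 0 < θ) (m : ℕ) : ‖baseVector θ m‖ = 1 := by
  have h1 : ((‖baseVector θ m‖ ^ 2 : ℝ) : ℂ) = 1 := by
    have h := inner_self_eq_norm_sq_to_K (𝕜 := ℂ) (baseVector θ m)
    rw [inner_baseVector θ hθ] at h
    have hint : ∀ w : ℂ, w ^ m * (starRingEnd ℂ) w ^ m *
        (((Real.sqrt 2 : ℂ) ^ (m + m))⁻¹ * (Real.exp (-(2 / θ) * ‖w‖ ^ 2) : ℂ)) =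
        (((2 ^ m)⁻¹ * (‖w‖ ^ ((2 * m : ℕ) : ℝ) * Real.exp (-(2 / θ) * ‖w‖ ^ (2 : ℝ))) : ℝ) : ℂ) := by
      intro w
      rw [← mul_pow, Complex.mul_conj, Complex.normSq_eq_norm_sq, ← two_mul, pow_mul, sqrt_two_sq,
        Real.rpow_natCast, pow_mul, Real.rpow_two]
      push_cast
      ring
    simp only [hint] at h
    rw [integral_complex_ofReal, integral_const_mul,
      Complex.integral_rpow_mul_exp_neg_mul_rpow one_le_two
        (by have : (0 : ℝ) ≤ ((2 * m : ℕ) : ℝ) := Nat.cast_nonneg _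
            linarith) (by positivity)] at h
    have e1 : (((2 * m : ℕ) : ℝ) + 2) / 2 = ((m + 1 : ℕ) : ℝ) := by push_cast; ring
    have e2 : -(((2 * m : ℕ) : ℝ) + 2) / 2 = -((m + 1 : ℕ) : ℝ) := by push_cast; ring
    rw [e1, e2, Real.rpow_neg (by positivity), Real.rpow_natCast, Nat.cast_succ,
      Real.Gamma_nat_eq_factorial] at h
    have hb : baseConst θ m * baseConst θ m =
        (2 * Real.pi * θ)⁻¹ * (θ ^ m * m.factorial)⁻¹ * 4 ^ (m + 1) := by
      have h2 : (4 : ℝ) ^ (m + 1) = 2 ^ (m + 1) * 2 ^ (m + 1) := by rw [← mul_pow]; norm_num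
      rw [baseConst, h2]
      have s1 := Real.mul_self_sqrt (show 0 ≤ 2 * Real.pi * θ by positivity)
      have s2 := Real.mul_self_sqrt (show 0 ≤ θ ^ m * (m.factorial : ℝ) by positivity)
      nth_rewrite 3 [← s1]
      nth_rewrite 3 [← s2]
      rw [mul_inv, mul_inv]
      ring
    rw [Complex.ofReal_pow]
    refine h.symm.trans ?_
    rw [← Complex.ofReal_mul, hb, ← Complex.ofReal_mul,
      Complex.ofReal_eq_one]
    rw [show (4 : ℝ) ^ (m + 1) = 2 ^ (m + 1) * 2 ^ (m + 1) by rw [← mul_pow]; norm_num]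
    rw [div_pow, pow_succ, pow_succ]
    field_simp
  have h2 : ‖baseVector θ m‖ ^ 2 = 1 := by exact_mod_cast h1
  exact (pow_eq_one_iff_of_nonneg (norm_nonneg _) two_ne_zero).1 h2

lemma orthonormal_baseVector (θ : ℝ) (hθ : 0 < θ) : Orthonormal ℂ (baseVector θ) := by
  refine ⟨norm_baseVector θ hθ, fun m n hmn => ?_⟩
  simp only
  rw [inner_baseVector θ hθ, integral_pow_mul_conj_pow_eq_zero hmn
    (fun r => ((Real.sqrt 2 : ℂ) ^ (m + n))⁻¹ * (Real.exp (-(2 / θ) * r ^ 2) : ℂ)), mul_zero]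

section

open Filter Topology

/-! ### States -/

lemma vectorState_apply (θ : ℝ) (ψ : L2) (T : cstar θ) :
    vectorState θ ψ T = inner ℂ ψ ((T : L2 →L[ℂ] L2) ψ) := rfl

lemma vectorState_toCstar (θ : ℝ) (ψ : L2) (a : 𝓢(Plane, ℂ)) :
    vectorState θ ψ (toCstar θ a) = inner ℂ ψ (leftMul θ a ψ) := rfl

lemma vectorState_star_mul_nonneg (θ : ℝ) (ψ : L2) (T : cstar θ) :
    0 ≤ vectorState θ ψ (star T * T) := by
  have h : vectorState θ ψ (star T * T) = ((‖(T : L2 →L[ℂ] L2) ψ‖ ^ 2 : ℝ) : ℂ) := by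
    have h1 : ((star T * T : cstar θ) : L2 →L[ℂ] L2) ψ =
      ContinuousLinearMap.adjoint (T : L2 →L[ℂ] L2) ((T : L2 →L[ℂ] L2) ψ) := rfl
    rw [vectorState_apply, h1, ContinuousLinearMap.adjoint_inner_right,
      inner_self_eq_norm_sq_to_K]
    push_cast
    rfl
  rw [h, Complex.zero_le_real]
  positivity

lemma norm_vectorState_le (θ : ℝ) {ψ : L2} (hψ : ‖ψ‖ = 1) (T : cstar θ) :
    ‖vectorState θ ψ T‖ ≤ ‖T‖ := by
  rw [vectorState_apply]
  refine (norm_inner_le_norm _ _).trans ?_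
  have h := (T : L2 →L[ℂ] L2).le_opNorm ψ
  rw [hψ, mul_one] at h
  rw [hψ, one_mul]
  exact h

/-- The approximate unit `L(exp (-|x|²/(θ (k+1))))`. -/
def approxUnit (θ : ℝ) (hθ : 0 < θ) (k : ℕ) : cstar θ :=
  toCstar θ (gaussian (θ * ((k : ℝ) + 1))⁻¹ (by positivity))

lemma norm_approxUnit_le (θ : ℝ) (hθ : 0 < θ) (k : ℕ) : ‖approxUnit θ hθ k‖ ≤ 1 :=
  norm_leftMul_gaussian_le θ hθ (θ * ((k : ℝ) + 1))⁻¹ (by positivity)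

/-- Contractivity bounds the norm by one, and the Gaussian contractions, standing in for a unit of
the non-unital algebra, show that one is the least bound. -/
lemma isState_of_tendsto_approxUnit (θ : ℝ) (hθ : 0 < θ) (φ : WeakDual ℂ (cstar θ))
    (hpos : ∀ T : cstar θ, 0 ≤ φ (star T * T)) (hle : ∀ T : cstar θ, ‖φ T‖ ≤ ‖T‖)
    (hlim : Tendsto (fun k => φ (approxUnit θ hθ k)) atTop (𝓝 1)) : IsState φ := by
  refine ⟨hpos, ?_, fun C hC => ?_⟩
  · rintro r ⟨T, hT, rfl⟩
    exact (hle T).trans hT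
  · have h := hlim.norm
    rw [norm_one] at h
    exact le_of_tendsto' h fun k => hC ⟨approxUnit θ hθ k, norm_approxUnit_le θ hθ k, rfl⟩

/-! ### Monotonicity, bounds and limits of the Gaussian eigenvalues -/

lemma gaussEigenvalue_nonneg {q : ℝ} (hq : 1 ≤ q) (m : ℕ) : 0 ≤ gaussEigenvalue q m :=
  mul_nonneg (by positivity) (pow_nonneg (div_nonneg (by linarith) (by positivity)) m)

lemma gaussEigenvalue_antitone {q : ℝ} (hq : 1 ≤ q) : Antitone (gaussEigenvalue q) := by
  intro m n hmn
  refine mul_le_mul_of_nonneg_left ?_ (by positivity)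
  exact pow_le_pow_of_le_one (div_nonneg (by linarith) (by positivity))
    ((div_le_one (by positivity)).2 (by linarith)) hmn

lemma gaussEigenvalue_le_one {q : ℝ} (hq : 1 ≤ q) (m : ℕ) : gaussEigenvalue q m ≤ 1 := by
  refine (gaussEigenvalue_antitone hq (Nat.zero_le m)).trans ?_
  rw [gaussEigenvalue, pow_zero, mul_one, div_le_one (by positivity)]
  linarith

lemma tendsto_gaussEigenvalue (m : ℕ) :
    Tendsto (fun k : ℕ => gaussEigenvalue ((k : ℝ) + 1) m) atTop (𝓝 1) := by
  have h : Tendsto (fun k : ℕ => 1 / (((k + 1 : ℕ) : ℝ) + 1)) atTop (𝓝 0) :=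
    (tendsto_add_atTop_iff_nat 1).2 tendsto_one_div_add_atTop_nhds_zero_nat
  have h2 : Tendsto (fun k : ℕ => (1 - 1 / (((k + 1 : ℕ) : ℝ) + 1)) *
      (1 - 2 * (1 / (((k + 1 : ℕ) : ℝ) + 1))) ^ m) atTop (𝓝 ((1 - 0) * (1 - 2 * 0) ^ m)) :=
    (h.const_sub 1).mul (((h.const_mul 2).const_sub 1).pow m)
  simp only [sub_zero, mul_zero, one_pow, mul_one] at h2
  refine h2.congr fun k => ?_
  rw [gaussEigenvalue]
  have : (k : ℝ) + 1 + 1 ≠ 0 := by positivity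
  congr 1
  · push_cast; field_simp; ring
  · congr 1; push_cast; field_simp; ring

lemma approxUnit_apply_baseVector (θ : ℝ) (hθ : 0 < θ) (k m : ℕ) :
    leftMul θ (gaussian (θ * ((k : ℝ) + 1))⁻¹ (by positivity)) (baseVector θ m) =
      (gaussEigenvalue ((k : ℝ) + 1) m : ℂ) • baseVector θ m :=
  leftMul_gaussian_baseVector θ hθ _ (by positivity) m

lemma tendsto_vectorState_baseVector (θ : ℝ) (hθ : 0 < θ) (n : ℕ) :
    Tendsto (fun k => vectorState θ (baseVector θ n) (approxUnit θ hθ k)) atTop (𝓝 1) := by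
  have h := (Complex.continuous_ofReal.tendsto 1).comp (tendsto_gaussEigenvalue n)
  rw [Complex.ofReal_one] at h
  refine h.congr fun k => ?_
  rw [approxUnit, vectorState_toCstar, approxUnit_apply_baseVector θ hθ, inner_smul_right,
    inner_self_eq_norm_sq_to_K, norm_baseVector θ hθ]
  simp

lemma isState_baseVector (θ : ℝ) (hθ : 0 < θ) (n : ℕ) :
    IsState (vectorState θ (baseVector θ n)) :=
  isState_of_tendsto_approxUnit θ hθ _ (vectorState_star_mul_nonneg θ _)
    (norm_vectorState_le θ (norm_baseVector θ hθ n)) (tendsto_vectorState_baseVector θ hθ n)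

/-! ### The vectors `ψ(s)` -/

/-- The weight `1 / (ζ(s) (m+1)^s)`. -/
def zetaWeight (s : ℝ) (m : ℕ) : ℝ := 1 / ((riemannZeta (s : ℂ)).re * ((m : ℝ) + 1) ^ s)

lemma hasSum_zeta {s : ℝ} (hs : 1 < s) :
    HasSum (fun m : ℕ => 1 / ((m : ℝ) + 1) ^ s) (riemannZeta (s : ℂ)).re := by
  have h1 : Summable fun m : ℕ => 1 / ((m : ℝ) + 1) ^ s := by
    have := (summable_nat_add_iff 1).2 (Real.summable_one_div_nat_rpow.2 hs)
    simpa using this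
  have h2 : riemannZeta (s : ℂ) = ((∑' m : ℕ, 1 / ((m : ℝ) + 1) ^ s : ℝ) : ℂ) := by
    rw [zeta_eq_tsum_one_div_nat_add_one_cpow (by simpa using hs), Complex.ofReal_tsum]
    refine tsum_congr fun m => ?_
    rw [Complex.ofReal_div, Complex.ofReal_cpow (by positivity)]
    push_cast
    rfl
  rw [h2, Complex.ofReal_re]
  exact h1.hasSum

lemma zeta_re_pos {s : ℝ} (hs : 1 < s) : 0 < (riemannZeta (s : ℂ)).re := by
  have h := le_hasSum (hasSum_zeta hs) 0 fun m _ => by positivity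
  norm_num at h
  linarith

lemma zetaWeight_pos {s : ℝ} (hs : 1 < s) (m : ℕ) : 0 < zetaWeight s m := by
  have := zeta_re_pos hs
  rw [zetaWeight]
  positivity

lemma hasSum_zetaWeight {s : ℝ} (hs : 1 < s) : HasSum (zetaWeight s) 1 := by
  have h := (hasSum_zeta hs).div_const (riemannZeta (s : ℂ)).re
  rw [div_self (zeta_re_pos hs).ne'] at h
  refine h.congr_fun fun m => ?_
  rw [zetaWeight, div_div, mul_comm]

lemma psiCoeff_sq {s : ℝ} (hs : 1 < s) (m : ℕ) : psiCoeff s m * psiCoeff s m = zetaWeight s m :=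
  Real.mul_self_sqrt (zetaWeight_pos hs m).le

lemma summable_psi (θ : ℝ) (hθ : 0 < θ) {s : ℝ} (hs : 1 < s) :
    Summable fun m : ℕ => (psiCoeff s m : ℂ) • baseVector θ m := by
  have h := (orthonormal_baseVector θ hθ).orthogonalFamily.summable_iff_norm_sq_summable
    fun m => (psiCoeff s m : ℂ)
  refine h.2 ((hasSum_zetaWeight hs).summable.congr fun m => ?_)
  rw [Complex.norm_real, Real.norm_eq_abs, sq_abs, sq, psiCoeff_sq hs]

/-- Expectation in `ψ(s)` of an operator diagonal in the `f_{m0}`. -/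
lemma hasSum_inner_psi (θ : ℝ) (hθ : 0 < θ) {s : ℝ} (hs : 1 < s) (T : L2 →L[ℂ] L2) (l : ℕ → ℝ)
    (hT : ∀ m, T (baseVector θ m) = (l m : ℂ) • baseVector θ m) :
    HasSum (fun m => ((zetaWeight s m * l m : ℝ) : ℂ)) (inner ℂ (psi θ s) (T (psi θ s))) := by
  have h1 := (summable_psi θ hθ hs).hasSum
  have h2 : ∀ m, inner ℂ (psi θ s) (baseVector θ m) = (psiCoeff s m : ℂ) := by
    intro m
    have h3 := ((innerSL ℂ (baseVector θ m)).hasSum h1)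
    have h4 : HasSum (fun j => innerSL ℂ (baseVector θ m) ((psiCoeff s j : ℂ) • baseVector θ j))
        (psiCoeff s m : ℂ) := by
      refine (hasSum_ite_eq m (psiCoeff s m : ℂ)).congr_fun fun j => ?_
      rw [innerSL_apply_apply, inner_smul_right,
        orthonormal_iff_ite.1 (orthonormal_baseVector θ hθ)]
      by_cases hj : j = m
      · simp [hj]
      · simp [hj, Ne.symm hj]
    have h5 := h3.unique h4
    rw [← inner_conj_symm]
    change (starRingEnd ℂ) (innerSL ℂ (baseVector θ m) (psi θ s)) = _
    rw [psi, h5, Complex.conj_ofReal]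
  have h6 := (innerSL ℂ (psi θ s)).hasSum (T.hasSum h1)
  refine h6.congr_fun fun m => ?_
  rw [innerSL_apply_apply, map_smul, hT, inner_smul_right, inner_smul_right, h2, ← psiCoeff_sq hs]
  push_cast
  ring

lemma norm_psi (θ : ℝ) (hθ : 0 < θ) {s : ℝ} (hs : 1 < s) : ‖psi θ s‖ = 1 := by
  have h1 := hasSum_inner_psi θ hθ hs (ContinuousLinearMap.id ℂ L2) (fun _ => 1) (by simp)
  have h2 : HasSum (fun m => ((zetaWeight s m * 1 : ℝ) : ℂ)) ((1 : ℝ) : ℂ) := by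
    simpa using Complex.hasSum_ofReal.2 (hasSum_zetaWeight hs)
  have h3 := h1.unique h2
  rw [ContinuousLinearMap.id_apply, inner_self_eq_norm_sq_to_K] at h3
  have h4 : ‖psi θ s‖ ^ 2 = 1 := by
    apply Complex.ofReal_injective
    rw [Complex.ofReal_pow]
    exact h3
  exact (pow_eq_one_iff_of_nonneg (norm_nonneg _) two_ne_zero).1 h4

/-- Dominated convergence: the eigenvalues lie in `[0, 1]`, tend to one for each `m`, and the zeta
weights are summable. -/
lemma tendsto_vectorState_psi (θ : ℝ) (hθ : 0 < θ) {s : ℝ} (hs : 1 < s) :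
    Tendsto (fun k => vectorState θ (psi θ s) (approxUnit θ hθ k)) atTop (𝓝 1) := by
  have h : Tendsto (fun k : ℕ => ∑' m, zetaWeight s m * gaussEigenvalue ((k : ℝ) + 1) m) atTop
      (𝓝 (∑' m, zetaWeight s m * 1)) := by
    refine tendsto_tsum_of_dominated_convergence (hasSum_zetaWeight hs).summable
      (fun m => (tendsto_gaussEigenvalue m).const_mul _) (Eventually.of_forall fun k m => ?_)
    have hk : (1 : ℝ) ≤ k + 1 := by simp
    rw [norm_mul, Real.norm_of_nonneg (zetaWeight_pos hs m).le,
      Real.norm_of_nonneg (gaussEigenvalue_nonneg hk m)]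
    exact mul_le_of_le_one_right (zetaWeight_pos hs m).le (gaussEigenvalue_le_one hk m)
  simp only [mul_one, (hasSum_zetaWeight hs).tsum_eq] at h
  have h' := (Complex.continuous_ofReal.tendsto 1).comp h
  rw [Complex.ofReal_one] at h'
  refine h'.congr fun k => ?_
  rw [approxUnit, vectorState_toCstar, Function.comp, Complex.ofReal_tsum]
  exact (hasSum_inner_psi θ hθ hs _ _ (approxUnit_apply_baseVector θ hθ k)).tsum_eq

lemma isState_psi (θ : ℝ) (hθ : 0 < θ) {s : ℝ} (hs : 1 < s) :
    IsState (vectorState θ (psi θ s)) :=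
  isState_of_tendsto_approxUnit θ hθ _ (vectorState_star_mul_nonneg θ _)
    (norm_vectorState_le θ (norm_psi θ hθ hs)) (tendsto_vectorState_psi θ hθ hs)

end

section

open Filter Topology LineDeriv

/-! ### Sums of dyadic Gaussians -/

/-- The Gaussian `exp (-|x|²/(θ 4^k))`. -/
def dyadicGaussian (θ : ℝ) (hθ : 0 < θ) (k : ℕ) : 𝓢(Plane, ℂ) :=
  gaussian (θ * 4 ^ k)⁻¹ (by positivity)

/-- The Schwartz function `∑_{k < N} 2^k exp (-|x|²/(θ 4^k))`. -/
def dyadicSum (θ : ℝ) (hθ : 0 < θ) (N : ℕ) : 𝓢(Plane, ℂ) :=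
  ∑ k ∈ Finset.range N, ((2 : ℝ) ^ k : ℂ) • dyadicGaussian θ hθ k

/-- Fourier inversion at the origin. -/
lemma integral_symplFourier (θ : ℝ) (hθ : θ ≠ 0) (a : 𝓢(Plane, ℂ)) (ha : a 0 = 0) :
    ∫ z, symplFourier θ hθ a z = 0 := by
  have h := symplFourier_inversion θ hθ a 0
  simp only [neg_zero, phase_zero_left, one_mul, ha] at h
  have hpi := Real.pi_ne_zero
  exact (mul_eq_zero.1 h).resolve_left
    (Complex.ofReal_ne_zero.2 (inv_ne_zero (pow_ne_zero 2 (mul_ne_zero hpi hθ))))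

/-- The weight `2^k` is chosen for scaling: the transform of the `k`-th Gaussian is a dilate with
factor `4^k`, while the linear form produced by the derivative loses `2^{-k}` when written in `2^k
z`. The mean is zero because the gradient of the Gaussian vanishes at the origin. -/
lemma exists_norm_leftMul_lineDerivOp_dyadicSum_le (θ : ℝ) (hθ : 0 < θ) (v : Plane) :
    ∃ C : ℝ, 0 ≤ C ∧ ∀ N : ℕ,
      ‖leftMul θ (∂_{v} (dyadicSum θ hθ N))‖ ≤ C * Real.sqrt N := by
  have hsum : ∀ N, (∂_{v} (dyadicSum θ hθ N) : 𝓢(Plane, ℂ)) =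
      ∑ k ∈ Finset.range N, ((2 : ℝ) ^ k : ℂ) • (∂_{v} (dyadicGaussian θ hθ k) : 𝓢(Plane, ℂ)) := by
    intro N
    rw [dyadicSum, lineDerivOp_sum]
    simp only [lineDerivOp_smul]
  have key := exists_norm_sum_dilates_le θ hθ
    (symplFourier θ hθ.ne' (∂_{v} (dyadicGaussian θ hθ 0)))
    (integral_symplFourier θ hθ.ne' _ (by
      rw [SchwartzMap.lineDerivOp_apply_eq_fderiv, dyadicGaussian, fderiv_gaussian_apply]
      simp))
    (fun k => ((2 : ℝ) ^ k : ℂ) • (∂_{v} (dyadicGaussian θ hθ k) : 𝓢(Plane, ℂ))) (by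
      intro k z
      have hf : form θ v ((2 : ℝ) ^ k • z) = 2 ^ k * form θ v z := by
        simp only [form, PiLp.smul_apply, smul_eq_mul]; ring
      have hn : ‖(2 : ℝ) ^ k • z‖ ^ 2 = 4 ^ k * ‖z‖ ^ 2 := by
        rw [norm_smul, mul_pow, Real.norm_of_nonneg (by positivity), ← pow_mul, mul_comm k,
          pow_mul]
        norm_num
      have he : -(θ ^ 2 * (θ * 4 ^ k)⁻¹)⁻¹ * ‖z‖ ^ 2 =
          -(θ ^ 2 * (θ * 4 ^ 0)⁻¹)⁻¹ * (4 ^ k * ‖z‖ ^ 2) := by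
        field_simp
      simp only [dyadicGaussian, symplFourier_smul, smul_apply, smul_eq_mul,
        symplFourier_lineDerivOp, symplFourier_gaussian, hf, hn, he]
      push_cast
      field_simp)
  obtain ⟨C, hC, h⟩ := key
  exact ⟨C, hC, fun N => by rw [hsum]; exact h N⟩

lemma exists_commutatorNorm_dyadicSum_le (θ : ℝ) (hθ : 0 < θ) :
    ∃ C : ℝ, 0 < C ∧ ∀ N : ℕ, 0 < N →
      commutatorNorm θ ((((C * Real.sqrt N)⁻¹ : ℝ) : ℂ) • dyadicSum θ hθ N) ≤ 1 := by
  choose C hC h using fun v => exists_norm_leftMul_lineDerivOp_dyadicSum_le θ hθ v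
  set e : Fin 2 → Plane := fun μ => EuclideanSpace.single μ 1 with he
  set K := 2 * ∑ μ : Fin 2, C (e μ) with hK
  have hK0 : 0 ≤ K := mul_nonneg zero_le_two (Finset.sum_nonneg fun μ _ => hC _)
  -- `K` may vanish a priori; adding one keeps the normalisation invertible.
  refine ⟨K + 1, by linarith, fun N hN => ?_⟩
  have hN' : 0 < Real.sqrt N := Real.sqrt_pos.2 (by exact_mod_cast hN)
  refine (commutatorNorm_le θ hθ.ne' _).trans ?_
  rw [ENNReal.ofReal_le_one]
  have h1 : ∀ μ : Fin 2, ‖leftMul θ (∂_{e μ} (((((K + 1) * Real.sqrt N)⁻¹ : ℝ) : ℂ) •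
      dyadicSum θ hθ N) : 𝓢(Plane, ℂ))‖ ≤
      ((K + 1) * Real.sqrt N)⁻¹ * (C (e μ) * Real.sqrt N) := by
    intro μ
    rw [lineDerivOp_smul, ← leftMulLinear_apply θ hθ.ne', map_smul, norm_smul,
      Complex.norm_real, Real.norm_of_nonneg (by positivity), leftMulLinear_apply]
    gcongr
    exact h (e μ) N
  calc 2 * ∑ μ : Fin 2, ‖leftMul θ (∂_{e μ} (((((K + 1) * Real.sqrt N)⁻¹ : ℝ) : ℂ) •
        dyadicSum θ hθ N) : 𝓢(Plane, ℂ))‖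
      ≤ 2 * ∑ μ : Fin 2, ((K + 1) * Real.sqrt N)⁻¹ * (C (e μ) * Real.sqrt N) := by
        gcongr with μ
        exact h1 μ
    _ = K / (K + 1) := by
        rw [← Finset.mul_sum, ← Finset.sum_mul, hK]
        field_simp
    _ ≤ 1 := (div_le_one (by linarith)).2 (by linarith)

/-! ### Expectation values of dyadic sums -/

lemma leftMul_dyadicSum (θ : ℝ) (hθ : 0 < θ) (N m : ℕ) :
    leftMul θ (dyadicSum θ hθ N) (baseVector θ m) =
      ((∑ k ∈ Finset.range N, 2 ^ k * gaussEigenvalue (4 ^ k) m : ℝ) : ℂ) • baseVector θ m := by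
  rw [dyadicSum, ← leftMulLinear_apply θ hθ.ne', map_sum, sum_apply,
    Complex.ofReal_sum, Finset.sum_smul]
  refine Finset.sum_congr rfl fun k _ => ?_
  rw [map_smul, smul_apply, leftMulLinear_apply, dyadicGaussian,
    leftMul_gaussian_baseVector θ hθ (4 ^ k) (by positivity), smul_smul]
  push_cast
  rfl

lemma one_le_four_pow (k : ℕ) : (1 : ℝ) ≤ 4 ^ k := one_le_pow₀ (by norm_num)

/-- Put `q = 4^k`. Bernoulli's inequality gives `((q+1)/(q-1))^q ≥ 2`, so the power in the
eigenvalue is at most `1/2` once `m ≥ q`, while the prefactor `q/(q+1)` is at least `1/2`. -/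
lemma gaussEigenvalue_gap {k m : ℕ} (hm : 4 ^ k ≤ m) :
    1 / 4 ≤ gaussEigenvalue (4 ^ k) 0 - gaussEigenvalue (4 ^ k) m := by
  set q : ℝ := 4 ^ k with hq
  have hq1 : 1 ≤ q := one_le_four_pow k
  have h0 : 1 / 2 ≤ q / (q + 1) := by
    rw [div_le_div_iff₀ two_pos (by linarith)]; linarith
  have hr0 : 0 ≤ (q - 1) / (q + 1) := div_nonneg (by linarith) (by linarith)
  have hr1 : (q - 1) / (q + 1) ≤ 1 := (div_le_one (by linarith)).2 (by linarith)
  have hb : ((q - 1) / (q + 1)) ^ (4 ^ k) ≤ 1 / 2 := by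
    -- At `q = 1` the base is zero and cannot be inverted.
    rcases hq1.eq_or_lt with h1 | h1
    · rw [← h1]
      simp
    · have hinv : 2 ≤ ((q + 1) / (q - 1)) ^ (4 ^ k) := by
        have hb := one_add_mul_le_pow (a := 2 / (q - 1)) (by
          have : 0 ≤ 2 / (q - 1) := div_nonneg zero_le_two (by linarith)
          linarith) (4 ^ k)
        have e : (q + 1) / (q - 1) = 1 + 2 / (q - 1) := by
          have : q - 1 ≠ 0 := by linarith
          field_simp
          ring
        rw [e]
        refine le_trans ?_ hb
        push_cast
        rw [← hq]
        have : 1 ≤ q * (2 / (q - 1)) := by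
          rw [← mul_div_assoc, le_div_iff₀ (by linarith)]
          linarith
        linarith
      rw [← inv_div, inv_pow, one_div]
      exact inv_anti₀ two_pos hinv
  have h1 : ((q - 1) / (q + 1)) ^ m ≤ 1 / 2 := (pow_le_pow_of_le_one hr0 hr1 hm).trans hb
  rw [gaussEigenvalue, gaussEigenvalue, pow_zero]
  nlinarith

/-- Bernoulli again, `1 - ((q-1)/(q+1))^n ≤ 2n/q` with `q = 4^k`. Summability in `k` means that
replacing `n` by `0` costs only a bounded amount over all scales. -/
lemma gaussEigenvalue_sub_le (k n : ℕ) :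
    2 ^ k * (gaussEigenvalue (4 ^ k) 0 - gaussEigenvalue (4 ^ k) n) ≤ 2 * n * (1 / 2) ^ k := by
  set q : ℝ := 4 ^ k with hq
  have hq1 : 1 ≤ q := one_le_four_pow k
  have e : (q - 1) / (q + 1) = 1 + -(2 / (q + 1)) := by
    have : q + 1 ≠ 0 := by linarith
    field_simp
    ring
  have hle : 2 / (q + 1) ≤ 1 := (div_le_one (by linarith)).2 (by linarith)
  have hb := one_add_mul_le_pow (a := -(2 / (q + 1))) (by linarith) n
  rw [← e] at hb
  have h1 : gaussEigenvalue q 0 - gaussEigenvalue q n ≤ n * (2 / q) := by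
    have hr0 : 0 ≤ (q - 1) / (q + 1) := div_nonneg (by linarith) (by linarith)
    have hr1 : (q - 1) / (q + 1) ≤ 1 := (div_le_one (by linarith)).2 (by linarith)
    have hle1 : q / (q + 1) ≤ 1 := (div_le_one (by linarith)).2 (by linarith)
    have hp1 : ((q - 1) / (q + 1)) ^ n ≤ 1 := pow_le_one₀ hr0 hr1
    have h2 : q / (q + 1) * (1 - ((q - 1) / (q + 1)) ^ n) ≤ 1 - ((q - 1) / (q + 1)) ^ n :=
      mul_le_of_le_one_left (by linarith) hle1
    have h3 : (n : ℝ) * (2 / (q + 1)) ≤ n * (2 / q) := by gcongr; linarith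
    rw [gaussEigenvalue, gaussEigenvalue, pow_zero]
    linarith
  calc 2 ^ k * (gaussEigenvalue q 0 - gaussEigenvalue q n) ≤ 2 ^ k * (n * (2 / q)) := by gcongr
    _ = 2 * n * (1 / 2) ^ k := by
      have : q = 2 ^ k * 2 ^ k := by rw [hq, ← mul_pow]; norm_num
      rw [this, one_div, inv_pow]
      field_simp

/-- The condition `s ≤ 3/2` enters here: `(m+1)^s ≤ (2·4^k)^{3/2} ≤ 4·8^k`. -/
lemma zetaWeight_ge {s : ℝ} (hs : 1 < s) (hs' : s ≤ 3 / 2) {k m : ℕ} (hm : m < 2 * 4 ^ k) :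
    ((riemannZeta (s : ℂ)).re * (4 * 8 ^ k))⁻¹ ≤ zetaWeight s m := by
  have hz := zeta_re_pos hs
  rw [zetaWeight, one_div]
  gcongr
  have h1 : (m : ℝ) + 1 ≤ 2 * 4 ^ k := by exact_mod_cast hm
  have h2 : (1 : ℝ) ≤ 2 * 4 ^ k := by linarith [one_le_four_pow k]
  calc ((m : ℝ) + 1) ^ s ≤ (2 * 4 ^ k) ^ s :=
        Real.rpow_le_rpow (by positivity) h1 (by linarith)
    _ ≤ (2 * 4 ^ k) ^ (3 / 2 : ℝ) := Real.rpow_le_rpow_of_exponent_le h2 hs'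
    _ = 2 ^ (3 / 2 : ℝ) * 8 ^ k := by
        rw [Real.mul_rpow zero_le_two (by positivity)]
        congr 1
        rw [show (4 : ℝ) = 2 ^ 2 by norm_num, show (8 : ℝ) = 2 ^ 3 by norm_num, ← pow_mul,
          ← pow_mul, mul_comm 2, mul_comm 3, pow_mul, pow_mul, ← Real.rpow_natCast (_ ^ k) 2,
          ← Real.rpow_mul (by positivity), ← Real.rpow_natCast (_ ^ k) 3]
        norm_num
    _ ≤ 4 * 8 ^ k := by
        gcongr
        calc (2 : ℝ) ^ (3 / 2 : ℝ) ≤ 2 ^ (2 : ℝ) :=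
              Real.rpow_le_rpow_of_exponent_le one_le_two (by norm_num)
          _ = 4 := by norm_num

lemma summable_zetaWeight_mul {s : ℝ} (hs : 1 < s) {q : ℝ} (hq : 1 ≤ q) :
    Summable fun m => zetaWeight s m * gaussEigenvalue q m :=
  (hasSum_zetaWeight hs).summable.of_nonneg_of_le
    (fun m => mul_nonneg (zetaWeight_pos hs m).le (gaussEigenvalue_nonneg hq m))
    fun m => mul_le_of_le_one_right (zetaWeight_pos hs m).le (gaussEigenvalue_le_one hq m)

/-- All terms `l 0 - l m` are nonnegative, so only the block `4^k ≤ m < 2·4^k` is kept: `4^k`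
indices, weight at least `1/(4ζ(s)8^k)`, gap at least `1/4`. Multiplied by `2^k`, the powers cancel
exactly. -/
lemma dyadic_gain {s : ℝ} (hs : 1 < s) (hs' : s ≤ 3 / 2) (k : ℕ) :
    (16 * (riemannZeta (s : ℂ)).re)⁻¹ ≤ 2 ^ k * (gaussEigenvalue (4 ^ k) 0 -
      ∑' m, zetaWeight s m * gaussEigenvalue (4 ^ k) m) := by
  set l := gaussEigenvalue (4 ^ k) with hl
  have h1 : HasSum (fun m => zetaWeight s m * (l 0 - l m))
      (l 0 - ∑' m, zetaWeight s m * l m) := by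
    have h2 := ((hasSum_zetaWeight hs).mul_right (l 0)).sub
      (summable_zetaWeight_mul hs (one_le_four_pow k)).hasSum
    rw [one_mul] at h2
    refine h2.congr_fun fun m => ?_
    simp only [hl]
    ring
  have hnn : ∀ m, 0 ≤ zetaWeight s m * (l 0 - l m) := fun m =>
    mul_nonneg (zetaWeight_pos hs m).le
      (sub_nonneg.2 (gaussEigenvalue_antitone (one_le_four_pow k) (Nat.zero_le m)))
  have h3 := sum_le_hasSum (Finset.Ico (4 ^ k) (2 * 4 ^ k)) (fun m _ => hnn m) h1
  have h4 : (4 : ℝ) ^ k * (((riemannZeta (s : ℂ)).re * (4 * 8 ^ k))⁻¹ * (1 / 4)) ≤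
      ∑ m ∈ Finset.Ico (4 ^ k) (2 * 4 ^ k), zetaWeight s m * (l 0 - l m) := by
    have hcard : (Finset.Ico (4 ^ k) (2 * 4 ^ k)).card = 4 ^ k := by
      rw [Nat.card_Ico]; omega
    have h5 := Finset.card_nsmul_le_sum (Finset.Ico (4 ^ k) (2 * 4 ^ k))
      (fun m => zetaWeight s m * (l 0 - l m))
      (((riemannZeta (s : ℂ)).re * (4 * 8 ^ k))⁻¹ * (1 / 4)) (fun m hm => by
        rw [Finset.mem_Ico] at hm
        exact mul_le_mul (zetaWeight_ge hs hs' hm.2) (gaussEigenvalue_gap hm.1) (by norm_num)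
          (zetaWeight_pos hs m).le)
    rw [hcard, nsmul_eq_mul] at h5
    exact_mod_cast h5
  calc (16 * (riemannZeta (s : ℂ)).re)⁻¹
      = 2 ^ k * ((4 : ℝ) ^ k * (((riemannZeta (s : ℂ)).re * (4 * 8 ^ k))⁻¹ * (1 / 4))) := by
        have : (8 : ℝ) ^ k = 2 ^ k * 4 ^ k := by rw [← mul_pow]; norm_num
        rw [this]
        field_simp
        norm_num
    _ ≤ _ := by
        gcongr
        exact h4.trans h3

/-- The dyadic sums separate `ω_n` and `ω_{ψ(s)}` by an amount growing linearly. -/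
lemma dyadicSum_separates (θ : ℝ) (hθ : 0 < θ) {s : ℝ} (hs : 1 < s) (hs' : s ≤ 3 / 2) (n N : ℕ) :
    (16 * (riemannZeta (s : ℂ)).re)⁻¹ * N - 4 * n ≤
      ‖vectorState θ (baseVector θ n) (toCstar θ (dyadicSum θ hθ N)) -
        vectorState θ (psi θ s) (toCstar θ (dyadicSum θ hθ N))‖ := by
  have h1 : vectorState θ (baseVector θ n) (toCstar θ (dyadicSum θ hθ N)) =
      ((∑ k ∈ Finset.range N, 2 ^ k * gaussEigenvalue (4 ^ k) n : ℝ) : ℂ) := by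
    rw [vectorState_toCstar, leftMul_dyadicSum, inner_smul_right, inner_self_eq_norm_sq_to_K,
      norm_baseVector θ hθ]
    simp
  have h2 : vectorState θ (psi θ s) (toCstar θ (dyadicSum θ hθ N)) =
      ((∑ k ∈ Finset.range N, 2 ^ k * ∑' m, zetaWeight s m * gaussEigenvalue (4 ^ k) m : ℝ) :
        ℂ) := by
    refine (hasSum_inner_psi θ hθ hs _ _ (leftMul_dyadicSum θ hθ N)).unique
      (Complex.hasSum_ofReal.2 ?_)
    have h3 := hasSum_sum (s := Finset.range N) fun k _ =>
      ((summable_zetaWeight_mul hs (one_le_four_pow k)).hasSum.mul_left ((2 : ℝ) ^ k))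
    refine h3.congr_fun fun m => ?_
    rw [Finset.mul_sum]
    exact Finset.sum_congr rfl fun k _ => by ring
  rw [h1, h2, ← Complex.ofReal_sub, Complex.norm_real, ← Finset.sum_sub_distrib]
  refine le_trans ?_ (Real.le_norm_self _)
  -- The total cost of comparing `n` with `0` is a geometric series.
  have h4 : ∑ k ∈ Finset.range N, 2 * (n : ℝ) * (1 / 2) ^ k ≤ 4 * n := by
    rw [← Finset.mul_sum]
    have h5 : ∑ k ∈ Finset.range N, (1 / 2 : ℝ) ^ k ≤ 2 :=
      sum_geometric_two_le N
    nlinarith [Nat.cast_nonneg (α := ℝ) n]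
  have h6 : ∑ k ∈ Finset.range N, (16 * (riemannZeta (s : ℂ)).re)⁻¹ =
      (16 * (riemannZeta (s : ℂ)).re)⁻¹ * N := by
    rw [Finset.sum_const, Finset.card_range, nsmul_eq_mul, mul_comm]
  rw [← h6]
  refine (sub_le_sub_left h4 _).trans ?_
  rw [← Finset.sum_sub_distrib]
  refine Finset.sum_le_sum fun k _ => ?_
  have h7 := dyadic_gain hs hs' k
  have h8 := gaussEigenvalue_sub_le k n
  linarith

/-! ### Divergence of the spectral distance -/

lemma toCstar_smul (θ : ℝ) (hθ : θ ≠ 0) (c : ℂ) (a : 𝓢(Plane, ℂ)) :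
    toCstar θ (c • a) = c • toCstar θ a :=
  Subtype.ext ((leftMulLinear θ hθ).map_smul c a)

/-- Dividing `a_N` by `C√N` makes it admissible, and the states then differ by at least `(cN -
4n)/(C√N)`. -/
lemma spectralDist_eq_top (θ : ℝ) (hθ : 0 < θ) {s : ℝ} (hs : 1 < s) (hs' : s ≤ 3 / 2) (n : ℕ) :
    spectralDist (vectorState θ (baseVector θ n)) (vectorState θ (psi θ s)) = ⊤ := by
  obtain ⟨C, hC, hcomm⟩ := exists_commutatorNorm_dyadicSum_le θ hθ
  have hz := zeta_re_pos hs
  set c := (16 * (riemannZeta (s : ℂ)).re)⁻¹ with hc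
  have hc0 : 0 < c := by positivity
  refine ENNReal.eq_top_of_forall_nnreal_le fun R => ?_
  obtain ⟨K, hK⟩ := exists_nat_ge ((C * R + 4 * n) / c)
  have hK' : C * R + 4 * n ≤ c * (K + 1) := by
    have := (div_le_iff₀ hc0).1 hK
    nlinarith
  -- A perfect square makes `√N` explicit; the choice of `K` yields `c(K+1)² - 4n ≥ CR(K+1)`.
  set N := (K + 1) ^ 2 with hN
  have hsq : Real.sqrt N = K + 1 := by
    rw [hN]; push_cast; exact Real.sqrt_sq (by positivity)
  have hle := hcomm N (by positivity)
  rw [hsq] at hle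
  refine le_trans ?_ (le_iSup₂ (f := fun (a : 𝓢(Plane, ℂ)) (_ : commutatorNorm θ a ≤ 1) =>
    ‖vectorState θ (baseVector θ n) (toCstar θ a) - vectorState θ (psi θ s) (toCstar θ a)‖ₑ) _ hle)
  have hsep := dyadicSum_separates θ hθ hs hs' n N
  rw [toCstar_smul θ hθ.ne', map_smul, map_smul, ← smul_sub, ← ofReal_norm, norm_smul,
    Complex.norm_real, Real.norm_of_nonneg (by positivity), ← ENNReal.ofReal_coe_nnreal]
  refine ENNReal.ofReal_le_ofReal ?_
  rw [inv_mul_eq_div, le_div_iff₀ (by positivity)]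
  refine le_trans ?_ hsep
  rw [hN, ← hc]
  push_cast
  have hR : 0 ≤ (R : ℝ) := R.2
  have hK0 : (0 : ℝ) ≤ K := Nat.cast_nonneg _
  have hn0 : (0 : ℝ) ≤ n := Nat.cast_nonneg _
  nlinarith [mul_le_mul_of_nonneg_right hK' (by positivity : (0 : ℝ) ≤ K + 1),
    mul_nonneg hn0 hK0]

/-! ### Comparison of the topologies -/

/-- The mixture `(1 - t) ω₀ + t ω_{ψ(s)}`. -/
def mixture (θ s t : ℝ) : WeakDual ℂ (cstar θ) :=
  ((1 - t : ℝ) : ℂ) • vectorState θ (baseVector θ 0) + (t : ℂ) • vectorState θ (psi θ s)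

lemma mixture_apply (θ s t : ℝ) (T : cstar θ) : mixture θ s t T =
    ((1 - t : ℝ) : ℂ) * vectorState θ (baseVector θ 0) T + (t : ℂ) * vectorState θ (psi θ s) T :=
  rfl

lemma continuous_mixture (θ s : ℝ) : Continuous (mixture θ s) := by
  unfold mixture
  fun_prop

lemma isState_mixture (θ : ℝ) (hθ : 0 < θ) {s t : ℝ} (hs : 1 < s) (ht0 : 0 ≤ t) (ht1 : t ≤ 1) :
    IsState (mixture θ s t) := by
  have ht1' : 0 ≤ 1 - t := sub_nonneg.2 ht1
  refine isState_of_tendsto_approxUnit θ hθ _ (fun T => ?_) (fun T => ?_) ?_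
  · rw [mixture_apply]
    exact add_nonneg
      (mul_nonneg (Complex.zero_le_real.2 ht1') (vectorState_star_mul_nonneg θ _ T))
      (mul_nonneg (Complex.zero_le_real.2 ht0) (vectorState_star_mul_nonneg θ _ T))
  · rw [mixture_apply]
    refine (norm_add_le _ _).trans ?_
    rw [norm_mul, norm_mul, Complex.norm_real, Complex.norm_real, Real.norm_of_nonneg ht1',
      Real.norm_of_nonneg ht0]
    have h1 := mul_le_mul_of_nonneg_left
      (norm_vectorState_le θ (norm_baseVector θ hθ 0) T) ht1'
    have h2 := mul_le_mul_of_nonneg_left (norm_vectorState_le θ (norm_psi θ hθ hs) T) ht0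
    linarith
  · simp only [mixture_apply]
    have h := ((tendsto_vectorState_baseVector θ hθ 0).const_mul ((1 - t : ℝ) : ℂ)).add
      ((tendsto_vectorState_psi θ hθ hs).const_mul (t : ℂ))
    convert h using 2
    push_cast
    ring

/-- `ω₀` minus the mixture is `t (ω₀ - ω_{ψ(s)})`, so the distance scales by `t`. -/
lemma spectralDist_mixture (θ : ℝ) (hθ : 0 < θ) {s t : ℝ} (hs : 1 < s) (hs' : s ≤ 3 / 2)
    (ht : 0 < t) : spectralDist (vectorState θ (baseVector θ 0)) (mixture θ s t) = ⊤ := by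
  have h : spectralDist (vectorState θ (baseVector θ 0)) (mixture θ s t) = ENNReal.ofReal t *
      spectralDist (vectorState θ (baseVector θ 0)) (vectorState θ (psi θ s)) := by
    simp only [spectralDist, ENNReal.mul_iSup]
    refine iSup_congr fun a => iSup_congr fun _ => ?_
    have h1 : ∀ u v : ℂ, u - (((1 - t : ℝ) : ℂ) * u + (t : ℂ) * v) = (t : ℂ) * (u - v) :=
      fun u v => by push_cast; ring
    rw [mixture_apply, h1, ← ofReal_norm, ← ofReal_norm, ← ENNReal.ofReal_mul ht.le, norm_mul,
      Complex.norm_real, Real.norm_of_nonneg ht.le]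
  rw [h, spectralDist_eq_top θ hθ hs hs', ENNReal.mul_top]
  simpa using ht

/-- The mixtures with `t = 1/(j+1)` converge weak* to `ω₀` but never enter its open unit ball for
`d`. -/
lemma spectralTopology_ne_weakStarTopology (θ : ℝ) (hθ : 0 < θ) :
    spectralTopology θ ≠ weakStarTopology θ := by
  intro heq
  have hs : (1 : ℝ) < 3 / 2 := by norm_num
  set φ₀ : StateSpace θ := ⟨vectorState θ (baseVector θ 0), isState_baseVector θ hθ 0⟩
  set t : ℕ → ℝ := fun j => 1 / ((j : ℝ) + 1) with ht
  have ht0 : ∀ j, 0 < t j := fun j => by positivity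
  have ht1 : ∀ j, t j ≤ 1 := fun j => by
    rw [ht]
    exact (div_le_one (by positivity)).2 (by simp)
  set φ : ℕ → StateSpace θ := fun j =>
    ⟨mixture θ (3 / 2) (t j), isState_mixture θ hθ hs (ht0 j).le (ht1 j)⟩ with hφ
  have hlim : Tendsto φ atTop (@nhds _ (weakStarTopology θ) φ₀) := by
    rw [tendsto_subtype_rng]
    have h0 : mixture θ (3 / 2) 0 = vectorState θ (baseVector θ 0) := by
      simp [mixture]
    have h1 := ((continuous_mixture θ (3 / 2)).tendsto 0).comp
      (tendsto_one_div_add_atTop_nhds_zero_nat (𝕜 := ℝ))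
    rw [h0] at h1
    exact h1
  rw [← heq] at hlim
  let _ : PseudoEMetricSpace (StateSpace θ) := spectralMetric θ
  have hball : Metric.eball φ₀ 1 ∈ @nhds _ (spectralTopology θ) φ₀ := Metric.eball_mem_nhds φ₀ one_pos
  obtain ⟨j, hj⟩ := (hlim.eventually hball).exists
  have hd : edist (φ j) φ₀ < 1 := hj
  rw [edist_comm] at hd
  have htop : edist φ₀ (φ j) = ⊤ := spectralDist_mixture θ hθ hs le_rfl (ht0 j)
  rw [htop] at hd
  exact absurd hd (by simp)

end

end Moyal

end

/-! ### The four assertions together -/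

theorem mainTheorem3 (θ : ℝ) (hθ : 0 < θ) :
    (∀ n : ℕ, ‖Moyal.baseVector θ n‖ = 1 ∧
      Moyal.IsState (Moyal.vectorState θ (Moyal.baseVector θ n))) ∧
    (∀ s : ℝ, 1 < s →
      Summable (fun m : ℕ => (Moyal.psiCoeff s m : ℂ) • Moyal.baseVector θ m) ∧
      ‖Moyal.psi θ s‖ = 1 ∧ Moyal.IsState (Moyal.vectorState θ (Moyal.psi θ s))) ∧
    (∀ s : ℝ, 1 < s → s ≤ 3 / 2 → ∀ n : ℕ,
      Moyal.spectralDist (Moyal.vectorState θ (Moyal.baseVector θ n))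
        (Moyal.vectorState θ (Moyal.psi θ s)) = ⊤) ∧
    Moyal.spectralTopology θ ≠ Moyal.weakStarTopology θ :=
  ⟨fun n => ⟨Moyal.norm_baseVector θ hθ n, Moyal.isState_baseVector θ hθ n⟩,
    fun _ hs => ⟨Moyal.summable_psi θ hθ hs, Moyal.norm_psi θ hθ hs, Moyal.isState_psi θ hθ hs⟩,
    fun _ hs hs' n => Moyal.spectralDist_eq_top θ hθ hs hs' n,
    Moyal.spectralTopology_ne_weakStarTopology θ hθ⟩
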